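/- Let $n\ge 1$. Let $\operatorname{Perm}(B_n)\subset\mathbb{R}^n$ be the type $B$ permutohedron, i.e. the convex hull of all points $(\pm\pi(1),\dots,\pm\pi(n))$, where $\pi$ runs over the permutations of $[1,n]=\{1,\dots,n\}$ and all choices of signs are allowed, and let $$\operatorname{Perm}(B_n)^*=\{y\in\mathbb{R}^n : \langle x,y\rangle\le 1 \text{ for all } x\in\operatorname{Perm}(B_n)\}$$ be its dual (polar) polytope. Let $\triangle(P([1,n])-\{\emptyset,[1,n]\})$ be the simplicial complex whose faces are the chains (including the empty one) of nonempty proper subsets of $[1,n]$, ordered by inclusion. The suspension of a simplicial complex is its join with the complex $\{\emptyset,\{a\},\{b\}\}$ on two new vertices $a,b$. For a finite simplicial complex $\triangle$ (the empty set counts as a face), a *Tchebyshev triangulation* of $\triangle$ is any complex obtained as follows: number all edges $e_1,\dots,e_m$ of $\triangle$ in some order, set $\triangle_0=\triangle$, and for $i=1,\dots,m$ let $\triangle_i$ be the stellar subdivision of $\triangle_{i-1}$ at the edge $e_i=\{u_i,v_i\}$ with a new vertex $w_i$, that is, remove all faces containing $e_i$ and add all faces $\sigma\cup\tau$, where $\sigma\in\{\emptyset,\{u_i\},\{v_i\},\{w_i\},\{u_i,w_i\},\{w_i,v_i\}\}$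 and $\tau$ is in the link of $e_i$ in $\triangle_{i-1}$; the result is $\triangle_m$. Then $\operatorname{Perm}(B_n)^*$ is a simplicial polytope (all its proper faces are simplices), and its boundary complex, i.e. the abstract simplicial complex of the vertex sets of its proper faces (including the empty face), is combinatorially equivalent (isomorphic as a simplicial complex) to some Tchebyshev triangulation of the suspension of $\triangle(P([1,n])-\{\emptyset,[1,n]\})$. -/

import Mathlib

/-!
Abstract simplicial complexes are treated as families `K : Set (Finset α)` of finite vertex sets;
the empty set counts as a face.  The vertices of `K` are the elements of its faces, so `K` need not
use all of `α`.
-/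

/-- The vertex set of a family of faces. -/
def vertexSet {α : Type*} (K : Set (Finset α)) : Set α :=
  {v | ∃ σ ∈ K, v ∈ σ}

/-- Combinatorial equivalence (isomorphism) of complexes: a bijection between the vertex sets
under which the faces correspond to each other. -/
def CombEquiv {α β : Type*} (K : Set (Finset α)) (L : Set (Finset β)) : Prop :=
  ∃ f : vertexSet K ≃ vertexSet L, ∀ s : Finset (vertexSet K),
    s.map (Function.Embedding.subtype _) ∈ K ↔
      (s.map f.toEmbedding).map (Function.Embedding.subtype _) ∈ L

/-- The order complex of a poset: its faces are the finite chains. -/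
def orderComplex (P : Type*) [PartialOrder P] : Set (Finset P) :=
  {σ | IsChain (· ≤ ·) (σ : Set P)}

/-- The join of two complexes, on the disjoint union of their vertex sets. -/
def simplicialJoin {α β : Type*} (K : Set (Finset α)) (L : Set (Finset β)) :
    Set (Finset (α ⊕ β)) :=
  {ρ | ∃ σ ∈ K, ∃ τ ∈ L, ρ = σ.disjSum τ}

/-- The boundary complex of the one-dimensional simplex with the two vertices `false`, `true`. -/
def boundaryOfSegment : Set (Finset Bool) :=
  {σ | σ ≠ Finset.univ}

/-- The suspension of a complex. -/
def suspension {α : Type*} (K : Set (Finset α)) : Set (Finset (α ⊕ Bool)) :=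
  simplicialJoin K boundaryOfSegment

/-- The link of a face. -/
def simplicialLink {α : Type*} [DecidableEq α] (K : Set (Finset α)) (σ : Finset α) :
    Set (Finset α) :=
  {τ | τ ∈ K ∧ Disjoint σ τ ∧ σ ∪ τ ∈ K}

/-- For an edge `e = {u, v}` and a new vertex `w`, the path `u - w - v` as a complex: its faces are
`∅`, `{u}`, `{v}`, `{w}`, `{u, w}`, `{w, v}`, that is, the subsets of `{u, v, w}` that do not
contain both `u` and `v`. -/
def subdividedEdge {α : Type*} [DecidableEq α] (e : Finset α) (w : α) : Set (Finset α) :=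
  {σ | σ ⊆ insert w e ∧ ¬ e ⊆ σ}

/-- The stellar subdivision of the edge `e` with the new vertex `w`: the faces `e ∪ τ`, for `τ` in
the link of `e`, are removed and replaced by the faces `σ ∪ τ`, for `σ` in the subdivided edge. -/
def stellarSubdivision {α : Type*} [DecidableEq α] (K : Set (Finset α)) (e : Finset α) (w : α) :
    Set (Finset α) :=
  {ρ | ρ ∈ K ∧ ¬ e ⊆ ρ} ∪
    {ρ | ∃ σ ∈ subdividedEdge e w, ∃ τ ∈ simplicialLink K e, ρ = σ ∪ τ}

/-- `T` is a Tchebyshev triangulation of `K`: for some numbering `e₁, e₂, …` of all edges of `K`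
(without repetition), `T` results from `K` by the stellar subdivisions of `e₁`, then `e₂`, and so
on.  An original vertex `v` is written `Sum.inl v`, the midpoint of the edge `e` is the new
vertex `Sum.inr e`. -/
def IsTchebyshevTriangulation {α : Type*} [DecidableEq α] (K : Set (Finset α))
    (T : Set (Finset (α ⊕ Finset α))) : Prop :=
  ∃ edges : List (Finset α), edges.Nodup ∧ (∀ e, e ∈ edges ↔ e ∈ K ∧ e.card = 2) ∧
    T = edges.foldl
      (fun L e => stellarSubdivision L (e.map Function.Embedding.inl) (Sum.inr e))
      ((fun σ : Finset α => σ.map Function.Embedding.inl) '' K)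

/-- The Boolean algebra of all subsets of an `n`-element set, without its minimum and maximum,
ordered by inclusion. -/
abbrev ProperNonemptySubset (n : ℕ) : Type :=
  {S : Finset (Fin n) // S ≠ ∅ ∧ S ≠ Finset.univ}

/-- The type `B` permutohedron: the convex hull of the points `(± π(1), …, ± π(n))`, where `π` is a
permutation of `{1, …, n}` (here `Fin n` is `{0, …, n - 1}`, whence the `+ 1`). -/
def permB (n : ℕ) : Set (Fin n → ℝ) :=
  convexHull ℝ {x | ∃ (π : Equiv.Perm (Fin n)) (ε : Fin n → ℤˣ),
    x = fun i => ((ε i : ℤ) : ℝ) * (((π i : ℕ) : ℝ) + 1)}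

/-- The polar dual `{y | ⟨x, y⟩ ≤ 1 for all x ∈ P}`; it is the dual polytope of a polytope `P` that
contains the origin in its interior. -/
def polarDual {n : ℕ} (P : Set (Fin n → ℝ)) : Set (Fin n → ℝ) :=
  {y | ∀ x ∈ P, ∑ i, x i * y i ≤ 1}

section Polytopes

variable {E : Type*} [AddCommGroup E] [Module ℝ E]

/-- A polytope is the convex hull of finitely many points. -/
def IsPolytope (Q : Set E) : Prop :=
  ∃ s : Finset E, Q = convexHull ℝ (s : Set E)

/-- A (possibly empty) geometric simplex is the convex hull of finitely many affinely independent
points. -/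
def IsGeometricSimplex (F : Set E) : Prop :=
  ∃ s : Finset E, AffineIndependent ℝ ((↑) : s → E) ∧ F = convexHull ℝ (s : Set E)

variable [TopologicalSpace E]

/-- A proper face of a polytope: the empty set, or the set of maximizers of a linear functional,
but not the whole polytope. -/
def IsProperFace (Q F : Set E) : Prop :=
  IsExposed ℝ Q F ∧ F ≠ Q

/-- A polytope is simplicial if all its proper faces are simplices. -/
def IsSimplicialPolytope (Q : Set E) : Prop :=
  IsPolytope Q ∧ ∀ F, IsProperFace Q F → IsGeometricSimplex F

/-- The boundary complex of a simplicial polytope, as an abstract complex: its faces are the vertex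
sets of the proper faces of the polytope. -/
def boundaryComplex (Q : Set E) : Set (Finset E) :=
  {s | ∃ F, IsProperFace Q F ∧ (s : Set E) = F.extremePoints ℝ}

end Polytopes

/-! Both complexes are identified with the order complex of one poset: the nonempty intervals of the
Boolean algebra on `Fin n`, other than the whole algebra, ordered by inclusion.

On the combinatorial side, the two suspension points play the roles of `∅` and the full set, so the
suspension is the complex of chains of the Boolean algebra that do not contain both. This is a flag
complex, and it stays one under edge subdivision (`stellarSubdivision_flagComplex`). The midpoint of
`{x, y}` with `x < y` stands for the interval `[x, y]`, and an original vertex for a one-element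
interval. If larger intervals are subdivided first, the link of an edge at its turn consists of the
vertices inside its interval and the midpoints of larger intervals
(`stellarSubdivision_partialAdj`), so that at the end adjacency is inclusion.

On the polytope side, an interval corresponds to a nonzero sign vector: `1` on the lower end, `-1`
off the upper end, `0` between. Inclusion becomes reversed restriction. Each nonzero sign vector,
scaled so that its maximum over the permutohedron is `1`, is a vertex of the dual. The facet given
by `π` and `ε` contains exactly the vertices of the compatible sign vectors (`sum_unit_mul_sign`).
Sorting coordinates by absolute value places every point in the cone over a facet
(`exists_eq_sum_signVertex`), so vertices on a common proper face form a chain. Conversely, every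
chain spans a face without further vertices, since each vertex of a facet can be dropped by passing
to a neighbouring facet (`exists_isCompatible_and_not`). -/

/-! ### Edge subdivision of flag complexes. -/

/-- The flag complex of a relation: its faces are the finite sets whose elements are pairwise
related.  The vertices are the elements that are related to themselves. -/
def flagComplex {α : Type*} (R : α → α → Prop) : Set (Finset α) :=
  {ρ | ∀ a ∈ ρ, ∀ b ∈ ρ, R a b}

theorem mem_vertexSet_flagComplex {α : Type*} {R : α → α → Prop} {a : α} :
    a ∈ vertexSet (flagComplex R) ↔ R a a := by
  constructor
  · rintro ⟨σ, hσ, ha⟩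
    exact hσ a ha a ha
  · intro h
    refine ⟨{a}, ?_, by simp⟩
    simpa [flagComplex] using h

/-- Subdividing an edge of a flag complex gives a flag complex. -/
theorem stellarSubdivision_flagComplex {α : Type*} [DecidableEq α] {R R' : α → α → Prop}
    {u v w : α} (hR : ∀ {a b}, R a b → R b a) (hR' : ∀ {a b}, R' a b → R' b a) (huv : u ≠ v)
    (hu : R u u) (hv : R v v) (hadj : R u v) (hw : ∀ a, ¬ R w a) (hw' : R' w w)
    (hold : ∀ a b, a ≠ w → b ≠ w → (R' a b ↔ R a b ∧ ({a, b} : Finset α) ≠ {u, v}))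
    (hnew : ∀ b, b ≠ w → (R' w b ↔ R b u ∧ R b v)) :
    stellarSubdivision (flagComplex R) {u, v} w = flagComplex R' := by
  have huw : u ≠ w := by rintro rfl; exact hw _ hu
  have hvw : v ≠ w := by rintro rfl; exact hw _ hv
  have hnw : ∀ {τ : Finset α}, τ ∈ flagComplex R → w ∉ τ := fun hτ h => hw _ (hτ w h w h)
  have hpair : ∀ a b : α, ({a, b} : Finset α) = {u, v} ↔ (a = u ∧ b = v ∨ a = v ∧ b = u) := by
    intro a b
    constructor
    · intro h
      have h1 : a ∈ ({u, v} : Finset α) := by rw [← h]; simp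
      have h2 : b ∈ ({u, v} : Finset α) := by rw [← h]; simp
      have h3 : u ∈ ({a, b} : Finset α) := by rw [h]; simp
      have h4 : v ∈ ({a, b} : Finset α) := by rw [h]; simp
      simp only [Finset.mem_insert, Finset.mem_singleton] at h1 h2 h3 h4
      grind
    · rintro (⟨rfl, rfl⟩ | ⟨rfl, rfl⟩)
      · rfl
      · exact Finset.pair_comm _ _
  have hsub : ∀ ρ : Finset α, ({u, v} : Finset α) ⊆ ρ ↔ u ∈ ρ ∧ v ∈ ρ := by
    intro ρ; simp [Finset.insert_subset_iff]
  ext ρ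
  constructor
  · rintro (⟨hρ, he⟩ | ⟨σ, ⟨hσ, hσe⟩, τ, ⟨hτ, hdis, hlink⟩, rfl⟩)
    · intro a ha b hb
      rw [hold a b (by rintro rfl; exact hnw hρ ha) (by rintro rfl; exact hnw hρ hb)]
      refine ⟨hρ a ha b hb, fun h => he ?_⟩
      rw [← h]
      simp [Finset.insert_subset_iff, ha, hb]
    · rw [hsub] at hσe
      -- Apart from `w`, the new face lies in the old face `{u, v} ∪ τ`, from which all old
      -- adjacencies are inherited.
      have key : ∀ a ∈ σ ∪ τ, a ≠ w → a ∈ ({u, v} : Finset α) ∪ τ := by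
        intro a ha haw
        rcases Finset.mem_union.1 ha with h | h
        · have := hσ h
          simp only [Finset.mem_insert, Finset.mem_singleton, Finset.mem_union] at this ⊢
          tauto
        · exact Finset.mem_union_right _ h
      have hnot : ∀ z ∈ ({u, v} : Finset α), z ∈ σ ∪ τ → z ∈ σ := by
        intro z hz h
        rcases Finset.mem_union.1 h with h | h
        · exact h
        · exact absurd h (Finset.disjoint_left.1 hdis hz)
      have hnotboth : ¬ (u ∈ σ ∪ τ ∧ v ∈ σ ∪ τ) := fun h =>
        hσe ⟨hnot u (by simp) h.1, hnot v (by simp) h.2⟩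
      have hwb : ∀ b ∈ σ ∪ τ, b ≠ w → R' w b := by
        intro b hb hbw
        rw [hnew b hbw]
        exact ⟨hlink b (key b hb hbw) u (by simp), hlink b (key b hb hbw) v (by simp)⟩
      intro a ha b hb
      by_cases haw : a = w
      · subst haw
        by_cases hbw : b = a
        · subst hbw; exact hw'
        · exact hwb b hb hbw
      · by_cases hbw : b = w
        · subst hbw; exact hR' (hwb a ha haw)
        · rw [hold a b haw hbw]
          refine ⟨hlink a (key a ha haw) b (key b hb hbw), fun h => hnotboth ?_⟩
          rcases (hpair a b).1 h with ⟨rfl, rfl⟩ | ⟨rfl, rfl⟩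
          · exact ⟨ha, hb⟩
          · exact ⟨hb, ha⟩
  · intro hρ
    have hRρ : ∀ a ∈ ρ, ∀ b ∈ ρ, a ≠ w → b ≠ w → R a b := fun a ha b hb haw hbw =>
      ((hold a b haw hbw).1 (hρ a ha b hb)).1
    have hnotboth : ¬ (({u, v} : Finset α) ⊆ ρ) := by
      rw [hsub]
      rintro ⟨h1, h2⟩
      exact ((hold u v huw hvw).1 (hρ u h1 v h2)).2 rfl
    by_cases hwρ : w ∈ ρ
    · right
      have hadjρ : ∀ b ∈ ρ, b ≠ w → R b u ∧ R b v := fun b hb hbw =>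
        (hnew b hbw).1 (hρ w hwρ b hb)
      -- The part outside the path is in the link of the edge: its elements are adjacent to `w`,
      -- hence to both `u` and `v`, and flagness does the rest.
      refine ⟨ρ ∩ {w, u, v}, ⟨?_, fun h => hnotboth (h.trans Finset.inter_subset_left)⟩,
        ρ \ {w, u, v}, ⟨?_, ?_, ?_⟩, ?_⟩
      · exact Finset.inter_subset_right
      · intro a ha b hb
        simp only [Finset.mem_sdiff, Finset.mem_insert, Finset.mem_singleton, not_or] at ha hb
        exact hRρ a ha.1 b hb.1 ha.2.1 hb.2.1
      · rw [Finset.disjoint_left]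
        intro a ha
        simp only [Finset.mem_sdiff, Finset.mem_insert, Finset.mem_singleton] at ha ⊢
        tauto
      · intro a ha b hb
        simp only [Finset.mem_union, Finset.mem_sdiff, Finset.mem_insert, Finset.mem_singleton,
          not_or] at ha hb
        rcases ha with (rfl | rfl) | ha <;> rcases hb with (rfl | rfl) | hb
        · exact hu
        · exact hadj
        · exact hR (hadjρ b hb.1 hb.2.1).1
        · exact hR hadj
        · exact hv
        · exact hR (hadjρ b hb.1 hb.2.1).2
        · exact (hadjρ a ha.1 ha.2.1).1
        · exact (hadjρ a ha.1 ha.2.1).2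
        · exact hRρ a ha.1 b hb.1 ha.2.1 hb.2.1
      · ext a
        simp only [Finset.mem_union, Finset.mem_sdiff, Finset.mem_inter]
        tauto
    · left
      exact ⟨fun a ha b hb => hRρ a ha b hb (by rintro rfl; exact hwρ ha)
        (by rintro rfl; exact hwρ hb), hnotboth⟩

/-! ### Subdividing comparability edges, larger intervals first. -/

section Intervals

variable {V Q : Type*} [Lattice Q] [BoundedOrder Q] (g : V → Q)

/-- The lower end of the interval of `Q` that is labelled by an element of `V` (an interval with a
single element) or by a subset of `V`. -/
def lowerEnd : V ⊕ Finset V → Q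
  | Sum.inl x => g x
  | Sum.inr e => e.inf g

/-- The upper end of the interval of `Q` that is labelled by an element of `V` (an interval with a
single element) or by a subset of `V`. -/
def upperEnd : V ⊕ Finset V → Q
  | Sum.inl x => g x
  | Sum.inr e => e.sup g

/-- The interval labelled by `a` is contained in the one labelled by `b`. -/
def IntervalLE (a b : V ⊕ Finset V) : Prop :=
  lowerEnd g b ≤ lowerEnd g a ∧ upperEnd g a ≤ upperEnd g b

/-- Two elements are comparable and are not the minimum and the maximum. -/
def ProperComparable (x y : V) : Prop :=
  (g x ≤ g y ∨ g y ≤ g x) ∧ ¬ (g x ⊓ g y = ⊥ ∧ g x ⊔ g y = ⊤)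

variable {g}

theorem ProperComparable.symm {x y : V} (h : ProperComparable g x y) : ProperComparable g y x :=
  ⟨h.1.symm, by rw [inf_comm, sup_comm]; exact h.2⟩

variable [DecidableEq V]

variable (g) in
/-- Adjacency in the complex in which the edges belonging to `D` are already subdivided. -/
def PartialAdj (D : Set (Finset V)) : V ⊕ Finset V → V ⊕ Finset V → Prop
  | Sum.inl x, Sum.inl y => ProperComparable g x y ∧ {x, y} ∉ D
  | Sum.inl x, Sum.inr e => e ∈ D ∧ IntervalLE g (Sum.inl x) (Sum.inr e)
  | Sum.inr e, Sum.inl x => e ∈ D ∧ IntervalLE g (Sum.inl x) (Sum.inr e)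
  | Sum.inr e, Sum.inr f => e ∈ D ∧ f ∈ D ∧
      (IntervalLE g (Sum.inr e) (Sum.inr f) ∨ IntervalLE g (Sum.inr f) (Sum.inr e))

variable (g) in
/-- The two-element sets of comparable elements other than the pair of minimum and maximum. -/
def properEdges : Set (Finset V) :=
  {e | ∃ x y, x ≠ y ∧ ProperComparable g x y ∧ e = {x, y}}

theorem PartialAdj.symm {D : Set (Finset V)} : ∀ {a b}, PartialAdj g D a b → PartialAdj g D b a := by
  rintro (x | e) (y | f) h
  · exact ⟨h.1.symm, by rw [Finset.pair_comm]; exact h.2⟩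
  · exact h
  · exact h
  · exact ⟨h.2.1, h.1, h.2.2.symm⟩

theorem exists_lt_of_mem_properEdges (hg : Function.Injective g) {e : Finset V}
    (he : e ∈ properEdges g) : ∃ x y, g x < g y ∧ ProperComparable g x y ∧ e = {x, y} := by
  obtain ⟨x, y, hxy, hc, rfl⟩ := he
  rcases hc.1 with h | h
  · exact ⟨x, y, lt_of_le_of_ne h (hg.ne hxy), hc, rfl⟩
  · exact ⟨y, x, lt_of_le_of_ne h (hg.ne hxy.symm), hc.symm, Finset.pair_comm _ _⟩

theorem lowerEnd_pair {x y : V} (h : g x ≤ g y) : lowerEnd g (Sum.inr {x, y}) = g x := by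
  simp [lowerEnd, h]

theorem upperEnd_pair {x y : V} (h : g x ≤ g y) : upperEnd g (Sum.inr {x, y}) = g y := by
  simp [upperEnd, h]

theorem eq_of_ends_eq (hg : Function.Injective g) {e f : Finset V} (he : e ∈ properEdges g)
    (hf : f ∈ properEdges g) (h : lowerEnd g (Sum.inr e) = lowerEnd g (Sum.inr f))
    (h' : upperEnd g (Sum.inr e) = upperEnd g (Sum.inr f)) : e = f := by
  obtain ⟨x, y, hxy, -, rfl⟩ := exists_lt_of_mem_properEdges hg he
  obtain ⟨z, w, hzw, -, rfl⟩ := exists_lt_of_mem_properEdges hg hf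
  rw [lowerEnd_pair hxy.le, lowerEnd_pair hzw.le] at h
  rw [upperEnd_pair hxy.le, upperEnd_pair hzw.le] at h'
  rw [hg h, hg h']

/-- Subdividing an edge such that exactly the edges spanning larger intervals have been subdivided
before. -/
theorem stellarSubdivision_partialAdj (hg : Function.Injective g) {D : Set (Finset V)}
    (hD : D ⊆ properEdges g) {e : Finset V} (he : e ∈ properEdges g) (heD : e ∉ D)
    (hlarge : ∀ f ∈ properEdges g, IntervalLE g (Sum.inr e) (Sum.inr f) → f ≠ e → f ∈ D)
    (hsmall : ∀ f ∈ D, ¬ IntervalLE g (Sum.inr f) (Sum.inr e)) :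
    stellarSubdivision (flagComplex (PartialAdj g D)) (e.map Function.Embedding.inl) (Sum.inr e) =
      flagComplex (PartialAdj g (insert e D)) := by
  obtain ⟨u, v, huv, hc, rfl⟩ := exists_lt_of_mem_properEdges hg he
  have hne : u ≠ v := by rintro rfl; exact lt_irrefl _ huv
  have hlo := lowerEnd_pair huv.le
  have hup := upperEnd_pair huv.le
  have hbt : (⊥ : Q) ≠ ⊤ := fun h =>
    huv.not_ge (le_top.trans (h.ge.trans bot_le))
  have hself : ∀ x, ProperComparable g x x := fun x => ⟨Or.inl le_rfl, by
    rw [inf_idem, sup_idem]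
    exact fun h => hbt (h.1.symm.trans h.2)⟩
  have hselfD : ∀ x, ({x, x} : Finset V) ∉ D := by
    intro x hx
    obtain ⟨a, b, hab, -, h⟩ := hD hx
    have := congrArg Finset.card h
    rw [Finset.card_pair hab] at this
    simp at this
  -- Edges inside `[u, v]`, including `{u, v}` itself, are still waiting to be subdivided.
  have hbetween : ∀ x y, g u ≤ g x → g x ≤ g y → g y ≤ g v → {x, y} ∉ D := by
    intro x y h1 h2 h3 h4
    refine hsmall _ h4 ⟨?_, ?_⟩
    · rw [hlo, lowerEnd_pair h2]; exact h1
    · rw [hup, upperEnd_pair h2]; exact h3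
  -- Edges around `[u, v]`, other than `{u, v}`, are already gone.
  have houter : ∀ x y, g x ≤ g u → g v ≤ g y → ({x, y} : Finset V) ≠ {u, v} →
      ProperComparable g x y → {x, y} ∈ D := by
    intro x y h1 h2 h3 h4
    have h5 : g x < g y := lt_of_le_of_lt h1 (huv.trans_le h2)
    refine hlarge _ ⟨x, y, fun h => h5.ne (by rw [h]), h4, rfl⟩ ⟨?_, ?_⟩ h3
    · rw [hlo, lowerEnd_pair h5.le]; exact h1
    · rw [hup, upperEnd_pair h5.le]; exact h2
  have hcu : ∀ x, g u ≤ g x → g x ≤ g v → ProperComparable g x u := fun x h1 h2 =>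
    ⟨Or.inr h1, fun h => hc.2 ⟨by rw [inf_eq_right.2 h1] at h; rw [inf_eq_left.2 huv.le]; exact h.1,
      by rw [sup_eq_left.2 h1] at h; rw [sup_eq_right.2 huv.le]
         exact top_le_iff.1 (h.2 ▸ h2)⟩⟩
  have hcv : ∀ x, g u ≤ g x → g x ≤ g v → ProperComparable g x v := fun x h1 h2 =>
    ⟨Or.inl h2, fun h => hc.2 ⟨by rw [inf_eq_left.2 h2] at h; rw [inf_eq_left.2 huv.le]
                                  exact le_bot_iff.1 (h.1 ▸ h1),
      by rw [sup_eq_right.2 h2] at h; rw [sup_eq_right.2 huv.le]; exact h.2⟩⟩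
  have hmap : (({u, v} : Finset V).map Function.Embedding.inl : Finset (V ⊕ Finset V)) =
      {Sum.inl u, Sum.inl v} := by
    simp [Finset.map_insert]
  have hmap' : ∀ x y, ({Sum.inl x, Sum.inl y} : Finset (V ⊕ Finset V)) = {Sum.inl u, Sum.inl v} ↔
      ({x, y} : Finset V) = {u, v} := by
    intro x y
    rw [← hmap, ← Finset.map_inj (f := (Function.Embedding.inl : V ↪ V ⊕ Finset V))]
    simp [Finset.map_insert]
  rw [hmap]
  apply stellarSubdivision_flagComplex (fun h => h.symm) (fun h => h.symm)
  · simpa using hne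
  · exact ⟨hself u, hselfD u⟩
  · exact ⟨hself v, hselfD v⟩
  · exact ⟨hc, heD⟩
  · rintro (x | f) h
    · exact heD h.1
    · exact heD h.1
  · exact ⟨Set.mem_insert _ _, Set.mem_insert _ _, Or.inl ⟨le_rfl, le_rfl⟩⟩
  · rintro (x | f) (y | f') ha hb
    · rw [Ne, hmap']
      simp only [PartialAdj, Set.mem_insert_iff, not_or]
      tauto
    · have : f' ≠ {u, v} := fun h => hb (by rw [h])
      have h2 : ({Sum.inl x, Sum.inr f'} : Finset (V ⊕ Finset V)) ≠ {Sum.inl u, Sum.inl v} := by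
        intro h
        have : (Sum.inr f' : V ⊕ Finset V) ∈ ({Sum.inl u, Sum.inl v} : Finset _) := by
          rw [← h]; simp
        simp at this
      simp [PartialAdj, this, h2]
    · have : f ≠ {u, v} := fun h => ha (by rw [h])
      have h2 : ({Sum.inr f, Sum.inl y} : Finset (V ⊕ Finset V)) ≠ {Sum.inl u, Sum.inl v} := by
        intro h
        have : (Sum.inr f : V ⊕ Finset V) ∈ ({Sum.inl u, Sum.inl v} : Finset _) := by
          rw [← h]; simp
        simp at this
      simp [PartialAdj, this, h2]
    · have h1 : f ≠ {u, v} := fun h => ha (by rw [h])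
      have h2 : f' ≠ {u, v} := fun h => hb (by rw [h])
      have h3 : ({Sum.inr f, Sum.inr f'} : Finset (V ⊕ Finset V)) ≠ {Sum.inl u, Sum.inl v} := by
        intro h
        have : (Sum.inr f : V ⊕ Finset V) ∈ ({Sum.inl u, Sum.inl v} : Finset _) := by
          rw [← h]; simp
        simp at this
      simp [PartialAdj, h1, h2, h3]
  · rintro (x | f) hb
    · constructor
      · rintro ⟨-, h1, h2⟩
        rw [hlo] at h1
        rw [hup] at h2
        refine ⟨⟨hcu x h1 h2, ?_⟩, ⟨hcv x h1 h2, hbetween x v h1 h2 le_rfl⟩⟩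
        rw [Finset.pair_comm]
        exact hbetween u x le_rfl h1 h2
      -- A common neighbour `x` of `u` and `v` lies between them: below `u` its edge to `v`, and
      -- above `v` its edge to `u`, would span a larger interval and be subdivided already.
      · rintro ⟨⟨h1, h2⟩, ⟨h3, h4⟩⟩
        refine ⟨Set.mem_insert _ _, ?_, ?_⟩
        · rw [hlo]
          change g u ≤ g x
          by_contra hux
          have hxu : g x ≤ g u := h1.1.resolve_right hux
          refine h4 (houter x v hxu le_rfl (fun h => ?_) h3)
          have : x ∈ ({u, v} : Finset V) := by rw [← h]; simp
          simp only [Finset.mem_insert, Finset.mem_singleton] at this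
          rcases this with rfl | rfl
          · exact hux le_rfl
          · exact hux huv.le
        · rw [hup]
          change g x ≤ g v
          by_contra hxv
          have hvx : g v ≤ g x := h3.1.resolve_left hxv
          rw [Finset.pair_comm] at h2
          refine h2 (houter u x le_rfl hvx (fun h => ?_) h1.symm)
          have : x ∈ ({u, v} : Finset V) := by rw [← h]; simp
          simp only [Finset.mem_insert, Finset.mem_singleton] at this
          rcases this with rfl | rfl
          · exact hxv huv.le
          · exact hxv le_rfl
    · have h1 : f ≠ {u, v} := fun h => hb (by rw [h])
      constructor
      · rintro ⟨-, hf, h⟩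
        have hf := hf.resolve_left h1
        obtain ⟨h2, h3⟩ := h.resolve_right (hsmall f hf)
        rw [hlo] at h2
        rw [hup] at h3
        exact ⟨⟨hf, h2, huv.le.trans h3⟩, ⟨hf, h2.trans huv.le, h3⟩⟩
      · rintro ⟨⟨hf, h2, -⟩, ⟨-, -, h3⟩⟩
        exact ⟨Set.mem_insert _ _, Or.inr hf, Or.inl ⟨by rw [hlo]; exact h2, by rw [hup]; exact h3⟩⟩

/-- Induction along the list, with `D` the set of edges already treated. Since `μ` is strictly
monotone under inclusion, an order of decreasing `μ` puts larger intervals first; ties occur only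
between incomparable intervals, so their order is irrelevant. -/
theorem foldl_stellarSubdivision_partialAdj (hg : Function.Injective g) {μ : Finset V → ℕ}
    (hμ : ∀ e ∈ properEdges g, ∀ f ∈ properEdges g, IntervalLE g (Sum.inr e) (Sum.inr f) →
      e ≠ f → μ e < μ f) (l : List (Finset V)) (D : Set (Finset V)) (hl : l.Nodup)
    (hdis : ∀ e ∈ l, e ∉ D) (hD : ∀ e, e ∈ D ∨ e ∈ l ↔ e ∈ properEdges g)
    (hsort : l.Pairwise fun e f => μ f ≤ μ e) (hDl : ∀ e ∈ D, ∀ f ∈ l, μ f ≤ μ e) :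
    l.foldl (fun L e => stellarSubdivision L (e.map Function.Embedding.inl) (Sum.inr e))
      (flagComplex (PartialAdj g D)) = flagComplex (PartialAdj g (properEdges g)) := by
  induction l generalizing D with
  | nil =>
    have : D = properEdges g := by ext e; simpa using hD e
    simp [this]
  | cons e l ih =>
    rw [List.nodup_cons] at hl
    rw [List.pairwise_cons] at hsort
    have he : e ∈ properEdges g := (hD e).1 (Or.inr (by simp))
    have hDE : D ⊆ properEdges g := fun f hf => (hD f).1 (Or.inl hf)
    have heD := hdis e (by simp)
    rw [List.foldl_cons, stellarSubdivision_partialAdj hg hDE he heD]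
    · refine ih (insert e D) hl.2 ?_ ?_ hsort.2 ?_
      · intro f hf hfD
        rcases hfD with rfl | hfD
        · exact hl.1 hf
        · exact hdis f (by simp [hf]) hfD
      · intro f
        rw [← hD f]
        simp only [Set.mem_insert_iff, List.mem_cons]
        tauto
      · rintro f (rfl | hf) k hk
        · exact hsort.1 k hk
        · exact hDl f hf k (by simp [hk])
    · intro f hf hef hne
      have hlt := hμ e he f hf hef hne.symm
      rcases (hD f).2 hf with h | h
      · exact h
      · rcases List.mem_cons.1 h with rfl | h
        · exact absurd rfl hne
        · exact absurd (hsort.1 f h) (not_le.2 hlt)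
    · intro f hf h
      have hne : f ≠ e := by rintro rfl; exact heD hf
      exact absurd (hDl f hf e (by simp)) (not_le.2 (hμ f (hDE hf) e he h hne))

theorem card_Icc_lt_card_Icc [LocallyFiniteOrder Q] (hg : Function.Injective g) {e f : Finset V}
    (he : e ∈ properEdges g) (hf : f ∈ properEdges g) (h : IntervalLE g (Sum.inr e) (Sum.inr f))
    (hne : e ≠ f) :
    (Finset.Icc (lowerEnd g (Sum.inr e)) (upperEnd g (Sum.inr e))).card <
      (Finset.Icc (lowerEnd g (Sum.inr f)) (upperEnd g (Sum.inr f))).card := by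
  classical
  refine Finset.card_lt_card ((Finset.Icc_subset_Icc h.1 h.2).ssubset_of_ne fun heq => hne ?_)
  have hle : ∀ {k : Finset V}, k ∈ properEdges g →
      lowerEnd g (Sum.inr k) ≤ upperEnd g (Sum.inr k) := by
    intro k hk
    obtain ⟨x, y, hxy, -, rfl⟩ := exists_lt_of_mem_properEdges hg hk
    rw [lowerEnd_pair hxy.le, upperEnd_pair hxy.le]
    exact hxy.le
  have h1 := (Finset.Icc_subset_Icc_iff (hle hf)).1 heq.ge
  exact eq_of_ends_eq hg he hf (le_antisymm h1.1 h.1) (le_antisymm h.2 h1.2)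

/-- Subdividing all edges in the order of decreasing interval size. -/
theorem isTchebyshevTriangulation_partialAdj [Finite V] [LocallyFiniteOrder Q]
    (hg : Function.Injective g) {K : Set (Finset V)}
    (hK : ∀ σ, σ ∈ K ↔ ∀ x ∈ σ, ∀ y ∈ σ, ProperComparable g x y)
    (hself : ∀ x, ProperComparable g x x) :
    IsTchebyshevTriangulation K (flagComplex (PartialAdj g (properEdges g))) := by
  classical
  have hfin : (properEdges g).Finite := Set.toFinite _
  set μ : Finset V → ℕ := fun e =>
    (Finset.Icc (lowerEnd g (Sum.inr e)) (upperEnd g (Sum.inr e))).card with hμ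
  -- The relation is reversed so that sorting yields decreasing interval size.
  let r : Finset V → Finset V → Prop := fun e f => μ f ≤ μ e
  have : Std.Total r := ⟨fun e f => le_total _ _⟩
  have : IsTrans (Finset V) r := ⟨fun e f k h1 h2 => le_trans h2 h1⟩
  let l := hfin.toFinset.toList.insertionSort r
  have hperm : l.Perm hfin.toFinset.toList := List.perm_insertionSort r _
  have hmem : ∀ e, e ∈ l ↔ e ∈ properEdges g := by
    intro e
    rw [hperm.mem_iff]
    simp
  have hnd : l.Nodup := hperm.nodup_iff.2 (Finset.nodup_toList _)
  refine ⟨l, hnd, ?_, ?_⟩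
  · intro e
    rw [hmem e]
    constructor
    · rintro ⟨x, y, hxy, hc, rfl⟩
      refine ⟨(hK _).2 ?_, Finset.card_pair hxy⟩
      intro a ha b hb
      simp only [Finset.mem_insert, Finset.mem_singleton] at ha hb
      rcases ha with rfl | rfl <;> rcases hb with rfl | rfl
      · exact hself _
      · exact hc
      · exact hc.symm
      · exact hself _
    · rintro ⟨he, hcard⟩
      obtain ⟨x, y, hxy, rfl⟩ := Finset.card_eq_two.1 hcard
      exact ⟨x, y, hxy, (hK _).1 he x (by simp) y (by simp), rfl⟩
  -- With nothing subdivided, no midpoint is a vertex and the flag complex is the original complex.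
  · have h0 : (fun σ : Finset V => σ.map Function.Embedding.inl) '' K =
        flagComplex (PartialAdj g ∅) := by
      ext ρ
      constructor
      · rintro ⟨σ, hσ, rfl⟩ a ha b hb
        simp only [Finset.mem_map, Function.Embedding.inl_apply] at ha hb
        obtain ⟨x, hx, rfl⟩ := ha
        obtain ⟨y, hy, rfl⟩ := hb
        exact ⟨(hK σ).1 hσ x hx y hy, Set.notMem_empty _⟩
      · intro hρ
        refine ⟨ρ.toLeft, (hK _).2 fun x hx y hy => ?_, ?_⟩
        · exact (hρ _ (Finset.mem_toLeft.1 hx) _ (Finset.mem_toLeft.1 hy)).1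
        · ext (x | e)
          · simp
          · constructor
            · intro h; simp at h
            · intro h; exact (hρ _ h _ h).1.elim
    rw [h0]
    symm
    refine foldl_stellarSubdivision_partialAdj hg (μ := μ) ?_ l ∅ hnd (by simp) ?_ ?_ (by simp)
    · exact fun e he f hf h hne => card_Icc_lt_card_Icc hg he hf h hne
    · intro e; simp [hmem]
    · exact List.pairwise_insertionSort r _

end Intervals

/-! ### The largest sums of `k` distinct elements of `{1, …, n}`. -/

section TopSum

/-- The sum of the `k` largest elements of `{1, …, n}`. -/
def topSum (n k : ℕ) : ℝ :=
  ∑ v ∈ Finset.univ.filter fun v : Fin n => n ≤ (v : ℕ) + k, ((v : ℕ) + 1 : ℝ)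

theorem card_filter_le_add {n k : ℕ} (hk : k ≤ n) :
    (Finset.univ.filter fun v : Fin n => n ≤ (v : ℕ) + k).card = k := by
  have h : (Finset.univ.filter fun v : Fin n => n ≤ (v : ℕ) + k).map Fin.valEmbedding =
      Finset.Ico (n - k) n := by
    ext a
    simp only [Finset.mem_map, Finset.mem_filter, Finset.mem_univ, true_and,
      Fin.valEmbedding_apply, Finset.mem_Ico]
    constructor
    · rintro ⟨v, hv, rfl⟩
      have := v.2
      omega
    · rintro ⟨h1, h2⟩
      exact ⟨⟨a, h2⟩, by simp only; omega, rfl⟩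
  rw [← Finset.card_map, h, Nat.card_Ico]
  omega

/-- Compare `A` with the top set `B` of the same size. Values on `A \ B` are at most `n - |A|`,
those on `B \ A` at least one more, and the two differences are equally large. The explicit gap
makes the equality case immediate. -/
theorem sum_add_card_sdiff_le_topSum {n : ℕ} (A : Finset (Fin n)) :
    ∑ v ∈ A, ((v : ℕ) + 1 : ℝ) +
      (A \ Finset.univ.filter fun v : Fin n => n ≤ (v : ℕ) + A.card).card ≤ topSum n A.card := by
  set B := Finset.univ.filter fun v : Fin n => n ≤ (v : ℕ) + A.card with hB
  have hcard : B.card = A.card := card_filter_le_add (by simpa using Finset.card_le_univ A)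
  have hAn : A.card ≤ n := by simpa using Finset.card_le_univ A
  have hd : (A \ B).card = (B \ A).card := by
    have h1 := Finset.card_sdiff_add_card_inter A B
    have h2 := Finset.card_sdiff_add_card_inter B A
    rw [Finset.inter_comm] at h2
    omega
  have h1 : ∑ v ∈ A \ B, ((v : ℕ) + 1 : ℝ) ≤ (A \ B).card • ((n : ℝ) - A.card) := by
    refine Finset.sum_le_card_nsmul _ _ _ fun v hv => ?_
    simp only [hB, Finset.mem_sdiff, Finset.mem_filter, Finset.mem_univ, true_and, not_le] at hv
    have : ((v : ℕ) + 1 + A.card : ℝ) ≤ n := by exact_mod_cast (by omega : (v : ℕ) + 1 + A.card ≤ n)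
    linarith
  have h2 : (B \ A).card • ((n : ℝ) - A.card + 1) ≤ ∑ v ∈ B \ A, ((v : ℕ) + 1 : ℝ) := by
    refine Finset.card_nsmul_le_sum _ _ _ fun v hv => ?_
    simp only [hB, Finset.mem_sdiff, Finset.mem_filter, Finset.mem_univ, true_and] at hv
    have : (n : ℝ) ≤ (v : ℕ) + A.card := by exact_mod_cast hv.1
    linarith
  have h3 := Finset.sum_inter_add_sum_sdiff A B fun v => ((v : ℕ) + 1 : ℝ)
  have h4 := Finset.sum_inter_add_sum_sdiff B A fun v => ((v : ℕ) + 1 : ℝ)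
  rw [Finset.inter_comm] at h4
  rw [← hd] at h2
  simp only [nsmul_eq_mul] at h1 h2
  change _ ≤ ∑ v ∈ B, ((v : ℕ) + 1 : ℝ)
  linarith

theorem sum_le_topSum {n : ℕ} (A : Finset (Fin n)) :
    ∑ v ∈ A, ((v : ℕ) + 1 : ℝ) ≤ topSum n A.card :=
  le_trans (le_add_of_nonneg_right (Nat.cast_nonneg _)) (sum_add_card_sdiff_le_topSum A)

theorem sum_eq_topSum_iff {n : ℕ} (A : Finset (Fin n)) :
    ∑ v ∈ A, ((v : ℕ) + 1 : ℝ) = topSum n A.card ↔ ∀ i ∈ A, ∀ j ∉ A, j < i := by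
  have hle := sum_add_card_sdiff_le_topSum A
  set B := Finset.univ.filter fun v : Fin n => n ≤ (v : ℕ) + A.card with hB
  have hcard : B.card = A.card := card_filter_le_add (by simpa using Finset.card_le_univ A)
  constructor
  · intro h
    have h0 : (A \ B).card = 0 := by
      have : ((A \ B).card : ℝ) ≤ 0 := by linarith
      exact Nat.le_zero.1 (by exact_mod_cast this)
    have hAB : A = B :=
      Finset.eq_of_subset_of_card_le (Finset.sdiff_eq_empty_iff_subset.1 (Finset.card_eq_zero.1 h0))
        hcard.le
    intro i hi j hj
    rw [hAB] at hi hj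
    simp only [hB, Finset.mem_filter, Finset.mem_univ, true_and, not_le] at hi hj
    rw [Fin.lt_def]
    omega
  · intro h
    have hAB : A ⊆ B := by
      intro i hi
      by_contra hiB
      have hlt : (B \ A).Nonempty := by
        rw [Finset.sdiff_nonempty]
        intro hBA
        rw [Finset.eq_of_subset_of_card_le hBA hcard.ge] at hiB
        exact hiB hi
      obtain ⟨j, hj⟩ := hlt
      rw [Finset.mem_sdiff] at hj
      have := h i hi j hj.2
      simp only [hB, Finset.mem_filter, Finset.mem_univ, true_and, not_le] at hj hiB
      rw [Fin.lt_def] at this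
      omega
    conv_lhs => rw [Finset.eq_of_subset_of_card_le hAB hcard.le]
    rfl

theorem topSum_card_pos {n : ℕ} {A : Finset (Fin n)} (hA : A.Nonempty) : 0 < topSum n A.card :=
  lt_of_lt_of_le (Finset.sum_pos (fun _ _ => by positivity) hA) (sum_le_topSum A)

end TopSum

/-! ### Chains of sign vectors and compatible signed permutations. -/

section SignVectors

variable {n : ℕ}

/-- The sign vector `s` is a restriction of `t`. -/
def IsRestriction (s t : Fin n → SignType) : Prop :=
  ∀ i, s i ≠ 0 → t i = s i

/-- The sign vector `s` has the signs `ε` on its support, which is where `π` is largest. -/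
def IsCompatible (π : Equiv.Perm (Fin n)) (ε : Fin n → ℤˣ) (s : Fin n → SignType) : Prop :=
  (∀ i, s i ≠ 0 → (s i : ℤ) = ε i) ∧ ∀ i j, s i ≠ 0 → s j = 0 → π j < π i

/-- Nonzero sign vectors that are pairwise restrictions of each other. -/
def IsSignChain (σ : Finset (Fin n → SignType)) : Prop :=
  (∀ s ∈ σ, s ≠ 0) ∧ ∀ s ∈ σ, ∀ t ∈ σ, IsRestriction s t ∨ IsRestriction t s

theorem SignType.intCast_injective' : Function.Injective ((↑) : SignType → ℤ) := by
  decide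

theorem IsCompatible.apply_eq {π : Equiv.Perm (Fin n)} {ε : Fin n → ℤˣ} {s t : Fin n → SignType}
    (hs : IsCompatible π ε s) (ht : IsCompatible π ε t) {i : Fin n} (hsi : s i ≠ 0)
    (hti : t i ≠ 0) : t i = s i :=
  SignType.intCast_injective' ((ht.1 i hti).trans (hs.1 i hsi).symm)

/-- Both supports are upper sets for the linear order given by `π`, hence nested, and on them both
signs are prescribed by `ε`. -/
theorem IsCompatible.isRestriction_or {π : Equiv.Perm (Fin n)} {ε : Fin n → ℤˣ}
    {s t : Fin n → SignType} (hs : IsCompatible π ε s) (ht : IsCompatible π ε t) :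
    IsRestriction s t ∨ IsRestriction t s := by
  by_contra! h
  simp only [IsRestriction, not_forall] at h
  obtain ⟨⟨i, hi, hi'⟩, j, hj, hj'⟩ := h
  have hti : t i = 0 := by
    by_contra hti
    exact hi' (hs.apply_eq ht hi hti)
  have hsj : s j = 0 := by
    by_contra hsj
    exact hj' (ht.apply_eq hs hj hsj)
  exact lt_asymm (hs.2 i j hi hsj) (ht.2 j i hj hti)

theorem IsCompatible.eq_of_support_eq {π : Equiv.Perm (Fin n)} {ε : Fin n → ℤˣ}
    {s t : Fin n → SignType} (hs : IsCompatible π ε s) (ht : IsCompatible π ε t)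
    (h : ∀ i, s i ≠ 0 ↔ t i ≠ 0) : s = t := by
  funext i
  by_cases hi : s i = 0
  · have : t i = 0 := by
      by_contra h'
      exact (h i).2 h' hi
    rw [hi, this]
  · exact (hs.apply_eq ht hi ((h i).1 hi)).symm

theorem exists_sort (f : Fin n → ℝ) :
    ∃ π : Equiv.Perm (Fin n), ∀ i j, π i ≤ π j → f i ≤ f j := by
  refine ⟨(Tuple.sort f).symm, fun i j h => ?_⟩
  simpa using Tuple.monotone_sort f h

/-- Rank each coordinate by the number of members of the chain that are nonzero there. If `s`
contains `i` but not `j` in its support, nestedness makes this count strictly larger at `i`. Signs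
agree along a chain; coordinates that no member uses get the arbitrary sign `1`. -/
theorem IsSignChain.exists_isCompatible {σ : Finset (Fin n → SignType)} (hσ : IsSignChain σ) :
    ∃ π ε, ∀ s ∈ σ, IsCompatible π ε s := by
  classical
  obtain ⟨π, hπ⟩ := exists_sort fun i : Fin n => ((σ.filter fun s : Fin n → SignType => s i ≠ 0).card : ℝ)
  have hsign : ∀ i, ∃ e : ℤˣ, ∀ s ∈ σ, s i ≠ 0 → (s i : ℤ) = e := by
    intro i
    by_cases h : ∃ s ∈ σ, s i ≠ 0
    · obtain ⟨s, hs, hsi⟩ := h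
      have hunit : ∀ z : SignType, z ≠ 0 → ∃ e : ℤˣ, (z : ℤ) = e := by
        intro z hz
        cases z
        · exact absurd rfl hz
        · exact ⟨-1, by simp⟩
        · exact ⟨1, by simp⟩
      obtain ⟨e, he⟩ := hunit _ hsi
      refine ⟨e, fun t ht hti => ?_⟩
      rw [← he]
      rcases hσ.2 s hs t ht with h | h
      · rw [h i hsi]
      · rw [h i hti]
    · push Not at h
      exact ⟨1, fun s hs hsi => absurd (h s hs) hsi⟩
  choose ε hε using hsign
  refine ⟨π, ε, fun s hs => ⟨fun i hi => hε i s hs hi, fun i j hi hj => ?_⟩⟩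
  by_contra hle
  have h := hπ i j (not_lt.1 hle)
  refine absurd h (not_le.2 ?_)
  refine Nat.cast_lt.2 (Finset.card_lt_card ?_)
  refine (Finset.ssubset_iff_of_subset ?_).2 ⟨s, by simp [hs, hi], by simp [hj]⟩
  intro t ht
  rw [Finset.mem_filter] at ht ⊢
  refine ⟨ht.1, ?_⟩
  rcases hσ.2 s hs t ht.1 with h | h
  · rw [h i hi]; exact hi
  · exact absurd ((h j ht.2).symm.trans hj) ht.2

/-- Any member of a chain can be removed by modifying `π` or `ε`. -/
theorem exists_isCompatible_and_not {π : Equiv.Perm (Fin n)} {ε : Fin n → ℤˣ}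
    {t : Fin n → SignType} (ht0 : t ≠ 0) (ht : IsCompatible π ε t) :
    ∃ π' ε', (∀ s, s ≠ t → IsCompatible π ε s → IsCompatible π' ε' s) ∧
      ¬ IsCompatible π' ε' t := by
  obtain ⟨i₀, hi₀⟩ := Function.ne_iff.1 ht0
  change t i₀ ≠ 0 at hi₀
  by_cases hfull : ∀ i, t i ≠ 0
  · have hn : 0 < n := i₀.pos
    -- Flip the sign at the coordinate of lowest rank: a compatible vector that is nonzero there has
    -- full support, so it equals `t`.
    set i := π.symm ⟨0, hn⟩ with hi
    have hπi : π i = ⟨0, hn⟩ := by simp [hi]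
    refine ⟨π, Function.update ε i (-ε i), fun s hst hs => ⟨fun j hj => ?_, hs.2⟩, fun h => ?_⟩
    · by_cases hji : j = i
      · exfalso
        subst hji
        refine hst (hs.eq_of_support_eq ht fun b => ⟨fun _ => hfull b, fun _ hb => ?_⟩)
        have := hs.2 _ b hj hb
        rw [hπi, Fin.lt_def] at this
        exact Nat.not_lt_zero _ this
      · rw [Function.update_of_ne hji]
        exact hs.1 j hj
    · have h1 := h.1 i (hfull i)
      have h2 := ht.1 i (hfull i)
      rw [Function.update_self, h2] at h1
      rcases Int.units_eq_one_or (ε i) with h3 | h3 <;> rw [h3] at h1 <;> simp at h1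
  · push Not at hfull
    obtain ⟨j, hj, hmax⟩ := Finset.exists_max_image (Finset.univ.filter fun j => t j = 0) π
      (by simpa [Finset.Nonempty] using hfull)
    rw [Finset.mem_filter] at hj
    have hj := hj.2
    have hmax : ∀ b, t b = 0 → π b ≤ π j := fun b hb => hmax b (by simp [hb])
    have hlt := ht.2 i₀ j hi₀ hj
    have hsucc : (π j : ℕ) + 1 < n := lt_of_le_of_lt hlt (π i₀).2
    set i := π.symm ⟨(π j : ℕ) + 1, hsucc⟩ with hi
    have hπi : (π i : ℕ) = (π j : ℕ) + 1 := by simp [hi]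
    have hti : t i ≠ 0 := by
      intro h
      have := hmax i h
      rw [Fin.le_def] at this
      omega
    have hij : i ≠ j := by rintro h; rw [h] at hπi; omega
    have hmem : ∀ b, t b ≠ 0 ↔ (π j : ℕ) < π b := by
      intro b
      constructor
      · intro hb
        exact ht.2 b j hb hj
      · intro hb h
        have := hmax b h
        rw [Fin.le_def] at this
        omega
    -- Exchange the ranks of `j`, the highest outside the support of `t`, and `i`, the next one
    -- above. Only a support that separates `i` from `j` is affected, and among compatible vectors
    -- only `t` has such a support.
    refine ⟨(Equiv.swap i j).trans π, ε, fun s hst hs => ⟨hs.1, fun a b ha hb => ?_⟩, fun h => ?_⟩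
    · have hab := hs.2 a b ha hb
      have hne : ¬ (a = i ∧ b = j) := by
        rintro ⟨rfl, rfl⟩
        refine hst (hs.eq_of_support_eq ht fun c => ?_)
        rw [hmem c]
        constructor
        · intro hc
          exact hs.2 c _ hc hb
        · intro hc hc0
          have := hs.2 _ c ha hc0
          rw [Fin.lt_def] at this
          omega
      have hval : ∀ c, c ≠ i → c ≠ j → (π c : ℕ) ≠ π i ∧ (π c : ℕ) ≠ π j := by
        intro c h1 h2
        constructor
        · intro h; exact h1 (π.injective (Fin.ext h))
        · intro h; exact h2 (π.injective (Fin.ext h))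
      simp only [Equiv.trans_apply, Fin.lt_def] at hab ⊢
      by_cases hai : a = i
      · subst hai
        by_cases hbi : b = i
        · subst hbi; omega
        · have hbj : b ≠ j := fun h => hne ⟨rfl, h⟩
          have := hval b hbi hbj
          rw [Equiv.swap_apply_left, Equiv.swap_apply_of_ne_of_ne hbi hbj]
          omega
      · by_cases haj : a = j
        · subst haj
          by_cases hbi : b = i
          · subst hbi; omega
          · by_cases hbj : b = a
            · subst hbj; omega
            · have := hval b hbi hbj
              rw [Equiv.swap_apply_right, Equiv.swap_apply_of_ne_of_ne hbi hbj]
              omega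
        · have h1 := hval a hai haj
          rw [Equiv.swap_apply_of_ne_of_ne hai haj]
          by_cases hbi : b = i
          · subst hbi
            rw [Equiv.swap_apply_left]
            omega
          · by_cases hbj : b = j
            · subst hbj
              rw [Equiv.swap_apply_right]
              omega
            · rw [Equiv.swap_apply_of_ne_of_ne hbi hbj]
              exact hab
    · have := h.2 i j hti hj
      simp only [Equiv.trans_apply, Equiv.swap_apply_left, Equiv.swap_apply_right,
        Fin.lt_def] at this
      omega

end SignVectors

/-! ### The vertices of the dual and the cones over its facets. -/

section Vertices

variable {n : ℕ}

/-- The support of a sign vector. -/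
def signSupport (s : Fin n → SignType) : Finset (Fin n) :=
  Finset.univ.filter fun i => s i ≠ 0

theorem mem_signSupport {s : Fin n → SignType} {i : Fin n} : i ∈ signSupport s ↔ s i ≠ 0 := by
  simp [signSupport]

/-- The vertex of the dual of the type `B` permutohedron that is a multiple of the sign vector
`s`. -/
noncomputable def signVertex (s : Fin n → SignType) : Fin n → ℝ :=
  fun i => ((s i : ℤ) : ℝ) / topSum n (signSupport s).card

/-- The linear functional given by a vertex of the type `B` permutohedron. -/
noncomputable def permFunctional (π : Equiv.Perm (Fin n)) (ε : Fin n → ℤˣ) :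
    StrongDual ℝ (Fin n → ℝ) :=
  ∑ i, (((ε i : ℤ) : ℝ) * (((π i : ℕ) : ℝ) + 1)) • ContinuousLinearMap.proj i

theorem permFunctional_apply (π : Equiv.Perm (Fin n)) (ε : Fin n → ℤˣ) (y : Fin n → ℝ) :
    permFunctional π ε y = ∑ i, ((ε i : ℤ) : ℝ) * (((π i : ℕ) : ℝ) + 1) * y i := by
  simp [permFunctional]

theorem mem_polarDual_permB {y : Fin n → ℝ} :
    y ∈ polarDual (permB n) ↔ ∀ π ε, permFunctional π ε y ≤ 1 := by
  constructor
  · intro h π ε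
    rw [permFunctional_apply]
    exact h _ (subset_convexHull ℝ _ ⟨π, ε, rfl⟩)
  · intro h x hx
    have hconv : Convex ℝ {x : Fin n → ℝ | ∑ i, x i * y i ≤ 1} := by
      refine convex_halfSpace_le ⟨fun a b => ?_, fun c a => ?_⟩ 1
      · simp [add_mul, Finset.sum_add_distrib]
      · simp [Finset.mul_sum, mul_assoc]
    refine convexHull_min ?_ hconv hx
    rintro _ ⟨π, ε, rfl⟩
    have := h π ε
    rwa [permFunctional_apply] at this

theorem topSum_signSupport_pos {s : Fin n → SignType} (hs : s ≠ 0) :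
    0 < topSum n (signSupport s).card := by
  obtain ⟨i, hi⟩ := Function.ne_iff.1 hs
  exact topSum_card_pos ⟨i, mem_signSupport.2 hi⟩

theorem unit_mul_sign_le (e : ℤˣ) (z : SignType) :
    (((e : ℤ) : ℝ) * ((z : ℤ) : ℝ)) ≤ (if z ≠ 0 then 1 else 0) ∧
      ((((e : ℤ) : ℝ) * ((z : ℤ) : ℝ)) = (if z ≠ 0 then 1 else 0) ↔ (z ≠ 0 → (z : ℤ) = e)) := by
  rcases Int.units_eq_one_or e with rfl | rfl <;> cases z <;> norm_num

/-- Two bounds are chained: replacing each term by its value with matching sign, then bounding the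
ranks on the support by the top sum. Equality in the first means that the signs agree, in the second
that the support is an upper set for `π`. -/
theorem sum_unit_mul_sign (π : Equiv.Perm (Fin n)) (ε : Fin n → ℤˣ) (s : Fin n → SignType) :
    ∑ i, ((ε i : ℤ) : ℝ) * (((π i : ℕ) : ℝ) + 1) * ((s i : ℤ) : ℝ) ≤
        topSum n (signSupport s).card ∧
      (∑ i, ((ε i : ℤ) : ℝ) * (((π i : ℕ) : ℝ) + 1) * ((s i : ℤ) : ℝ) =
        topSum n (signSupport s).card ↔ IsCompatible π ε s) := by
  have hterm : ∀ i ∈ Finset.univ, ((ε i : ℤ) : ℝ) * (((π i : ℕ) : ℝ) + 1) * ((s i : ℤ) : ℝ) ≤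
      (if s i ≠ 0 then 1 else 0) * (((π i : ℕ) : ℝ) + 1) := by
    intro i _
    rw [mul_right_comm]
    exact mul_le_mul_of_nonneg_right (unit_mul_sign_le _ _).1 (by positivity)
  have hsum : ∑ i, (if s i ≠ 0 then (1 : ℝ) else 0) * (((π i : ℕ) : ℝ) + 1) =
      ∑ v ∈ (signSupport s).map π.toEmbedding, ((v : ℕ) + 1 : ℝ) := by
    rw [Finset.sum_map, signSupport, Finset.sum_filter]
    refine Finset.sum_congr rfl fun i _ => ?_
    split_ifs <;> simp
  have htop := sum_le_topSum ((signSupport s).map π.toEmbedding)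
  have htop' := sum_eq_topSum_iff ((signSupport s).map π.toEmbedding)
  rw [Finset.card_map, ← hsum] at htop htop'
  have hle := Finset.sum_le_sum hterm
  have heq := Finset.sum_eq_sum_iff_of_le hterm
  refine ⟨hle.trans htop, ?_⟩
  have h1 : (∀ i ∈ Finset.univ, ((ε i : ℤ) : ℝ) * (((π i : ℕ) : ℝ) + 1) * ((s i : ℤ) : ℝ) =
      (if s i ≠ 0 then 1 else 0) * (((π i : ℕ) : ℝ) + 1)) ↔
      ∀ i, s i ≠ 0 → (s i : ℤ) = ε i := by
    refine forall_congr' fun i => ?_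
    have hpos : (((π i : ℕ) : ℝ) + 1) ≠ 0 := by positivity
    rw [mul_right_comm, mul_left_inj' hpos, (unit_mul_sign_le _ _).2]
    simp
  have h2 : (∀ i ∈ (signSupport s).map π.toEmbedding, ∀ j ∉ (signSupport s).map π.toEmbedding,
      j < i) ↔ ∀ i j, s i ≠ 0 → s j = 0 → π j < π i := by
    constructor
    · intro h i j hi hj
      refine h (π i) ?_ (π j) ?_
      · simpa [mem_signSupport] using hi
      · simpa [mem_signSupport] using hj
    · intro h i hi j hj
      obtain ⟨i, rfl⟩ := π.surjective i
      obtain ⟨j, rfl⟩ := π.surjective j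
      refine h i j ?_ ?_
      · simpa [mem_signSupport] using hi
      · simpa [mem_signSupport] using hj
  rw [IsCompatible, ← h1, ← h2, ← heq, ← htop']
  constructor
  · intro h
    constructor <;> linarith
  · rintro ⟨h3, h4⟩
    exact h3.trans h4

theorem permFunctional_signVertex (π : Equiv.Perm (Fin n)) (ε : Fin n → ℤˣ)
    (s : Fin n → SignType) :
    permFunctional π ε (signVertex s) =
      (∑ i, ((ε i : ℤ) : ℝ) * (((π i : ℕ) : ℝ) + 1) * ((s i : ℤ) : ℝ)) /
        topSum n (signSupport s).card := by
  rw [permFunctional_apply, Finset.sum_div]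
  exact Finset.sum_congr rfl fun i _ => (mul_div_assoc _ _ _).symm

theorem permFunctional_signVertex_le (π : Equiv.Perm (Fin n)) (ε : Fin n → ℤˣ)
    {s : Fin n → SignType} (hs : s ≠ 0) : permFunctional π ε (signVertex s) ≤ 1 := by
  rw [permFunctional_signVertex, div_le_one (topSum_signSupport_pos hs)]
  exact (sum_unit_mul_sign π ε s).1

theorem permFunctional_signVertex_eq_one {π : Equiv.Perm (Fin n)} {ε : Fin n → ℤˣ}
    {s : Fin n → SignType} (hs : s ≠ 0) :
    permFunctional π ε (signVertex s) = 1 ↔ IsCompatible π ε s := by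
  rw [permFunctional_signVertex, div_eq_one_iff_eq (topSum_signSupport_pos hs).ne']
  exact (sum_unit_mul_sign π ε s).2

theorem signVertex_mem {s : Fin n → SignType} (hs : s ≠ 0) :
    signVertex s ∈ polarDual (permB n) :=
  mem_polarDual_permB.2 fun π ε => permFunctional_signVertex_le π ε hs

/-- Every vector is a nonnegative combination of the vertices belonging to some `π` and `ε`. -/
theorem exists_eq_sum_signVertex (y : Fin n → ℝ) :
    ∃ (π : Equiv.Perm (Fin n)) (ε : Fin n → ℤˣ) (w : Fin n → ℝ)
      (s : Fin n → Fin n → SignType), (∀ p, 0 ≤ w p) ∧ (∀ p, s p ≠ 0) ∧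
      (∀ p, IsCompatible π ε (s p)) ∧ y = ∑ p, w p • signVertex (s p) := by
  obtain ⟨π, hπ⟩ := exists_sort fun i => |y i|
  have hsign : ∀ i, ∃ e : ℤˣ, y i = |y i| * (e : ℤ) := by
    intro i
    rcases le_total 0 (y i) with h | h
    · exact ⟨1, by simp [abs_of_nonneg h]⟩
    · exact ⟨-1, by simp [abs_of_nonpos h]⟩
  choose ε hε using hsign
  -- `f k` is the `k`-th smallest absolute value, counted from one. The value `f 0 = 0` starts the
  -- telescoping sum.
  let f : ℕ → ℝ := fun k => if h : 0 < k ∧ k ≤ n then |y (π.symm ⟨k - 1, by omega⟩)| else 0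
  have hf0 : f 0 = 0 := by simp [f]
  have hf : ∀ i, f ((π i : ℕ) + 1) = |y i| := by
    intro i
    have : (π i : ℕ) + 1 ≤ n := (π i).2
    simp [f, this]
  have hmono : ∀ p : Fin n, f p ≤ f ((p : ℕ) + 1) := by
    intro p
    have h1 := hf (π.symm p)
    rw [Equiv.apply_symm_apply] at h1
    rw [h1]
    rcases Nat.eq_zero_or_pos (p : ℕ) with h0 | h0
    · rw [h0, hf0]; exact abs_nonneg _
    · have h2 := hf (π.symm ⟨(p : ℕ) - 1, by omega⟩)
      rw [Equiv.apply_symm_apply] at h2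
      simp only [Nat.sub_add_cancel h0] at h2
      rw [h2]
      refine hπ _ _ ?_
      simp only [Equiv.apply_symm_apply, Fin.le_def]
      omega
  let e : Fin n → SignType := fun i => SignType.sign ((ε i : ℤ))
  have he : ∀ i, e i ≠ 0 ∧ (e i : ℤ) = ε i := by
    intro i
    rcases Int.units_eq_one_or (ε i) with h | h <;> simp [e, h]
  let s : Fin n → Fin n → SignType := fun p i => if p ≤ π i then e i else 0
  have hs : ∀ p i, s p i ≠ 0 ↔ p ≤ π i := by
    intro p i
    by_cases h : p ≤ π i <;> simp [s, h, (he i).1]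
  have hs0 : ∀ p, s p ≠ 0 := fun p h => by
    have := (hs p (π.symm p)).2 (by simp)
    rw [h] at this
    exact this rfl
  -- Layer decomposition: `s p` carries the signs on the coordinates of rank at least `p`, weighted
  -- by the increment of `f`. The factor `topSum` cancels the normalization of `signVertex`.
  refine ⟨π, ε, fun p => (f ((p : ℕ) + 1) - f p) * topSum n (signSupport (s p)).card, s,
    fun p => mul_nonneg (sub_nonneg.2 (hmono p)) (topSum_signSupport_pos (hs0 p)).le, hs0,
    fun p => ⟨fun i hi => ?_, fun i j hi hj => ?_⟩, ?_⟩
  · rw [hs] at hi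
    simp only [s, if_pos hi, (he i).2]
  · rw [hs] at hi
    have : ¬ p ≤ π j := fun h => (hs p j).2 h hj
    exact (not_le.1 this).trans_le hi
  · funext i
    rw [Finset.sum_apply, hε i]
    have hterm : ∀ p : Fin n, ((f ((p : ℕ) + 1) - f p) * topSum n (signSupport (s p)).card) •
        signVertex (s p) i = (if (p : ℕ) ≤ π i then (f ((p : ℕ) + 1) - f p) else 0) * (ε i : ℤ) := by
      intro p
      have hne := (topSum_signSupport_pos (hs0 p)).ne'
      by_cases h : p ≤ π i
      · rw [if_pos (Fin.le_def.1 h)]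
        simp only [signVertex, s, if_pos h, (he i).2, smul_eq_mul] at hne ⊢
        field_simp
      · rw [if_neg (fun h' => h (Fin.le_def.2 h'))]
        simp [signVertex, s, if_neg h]
    simp only [Pi.smul_apply]
    rw [Finset.sum_congr rfl fun p _ => hterm p, ← Finset.sum_mul]
    congr 1
    rw [Fin.sum_univ_eq_sum_range (fun p => if p ≤ (π i : ℕ) then f (p + 1) - f p else 0) n,
      ← Finset.sum_filter]
    have : (Finset.range n).filter (fun p => p ≤ (π i : ℕ)) = Finset.range ((π i : ℕ) + 1) := by
      ext p
      have := (π i).2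
      simp only [Finset.mem_filter, Finset.mem_range]
      omega
    rw [this, Finset.sum_range_sub, hf, hf0, sub_zero]

end Vertices

/-! ### Proper faces of the dual correspond to chains of sign vectors. -/

section Faces

variable {n : ℕ}

theorem convex_polarDual_permB : Convex ℝ (polarDual (permB n)) := by
  intro x hx y hy a b ha hb hab
  rw [mem_polarDual_permB] at hx hy ⊢
  intro π ε
  rw [map_add, map_smul, map_smul, smul_eq_mul, smul_eq_mul]
  have h1 := mul_le_mul_of_nonneg_left (hx π ε) ha
  have h2 := mul_le_mul_of_nonneg_left (hy π ε) hb
  linarith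

theorem zero_mem_polarDual_permB : (0 : Fin n → ℝ) ∈ polarDual (permB n) :=
  mem_polarDual_permB.2 fun π ε => by simp

theorem permFunctional_neg (π : Equiv.Perm (Fin n)) (ε : Fin n → ℤˣ) (y : Fin n → ℝ) :
    permFunctional π ε (-y) = permFunctional π (-ε) y := by
  rw [permFunctional_apply, permFunctional_apply]
  exact Finset.sum_congr rfl fun i _ => by simp

theorem neg_mem_polarDual_permB {y : Fin n → ℝ} (hy : y ∈ polarDual (permB n)) :
    -y ∈ polarDual (permB n) := by
  rw [mem_polarDual_permB] at hy ⊢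
  intro π ε
  rw [permFunctional_neg]
  exact hy _ _

theorem signVertex_neg (s : Fin n → SignType) : signVertex (-s) = -signVertex s := by
  have h : signSupport (-s) = signSupport s := by
    ext i; simp [mem_signSupport]
  funext i
  have h2 : ∀ z : SignType, ((-z : SignType) : ℤ) = -(z : ℤ) := by decide
  simp only [signVertex, h, Pi.neg_apply, h2]
  push_cast
  ring

/-- In the conic decomposition of a point `y` of the dual, the facet functional evaluates to the
total weight, which is thus at most `1`. The missing weight goes to the origin, the midpoint of two
opposite vertices. -/
theorem polarDual_permB_eq_convexHull (hn : 1 ≤ n) :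
    polarDual (permB n) = convexHull ℝ (signVertex '' {s : Fin n → SignType | s ≠ 0}) := by
  apply Set.Subset.antisymm
  · intro y hy
    set C := convexHull ℝ (signVertex '' {s : Fin n → SignType | s ≠ 0}) with hC
    have hmem : ∀ s : Fin n → SignType, s ≠ 0 → signVertex s ∈ C := fun s hs =>
      subset_convexHull ℝ _ ⟨s, hs, rfl⟩
    have hconv : Convex ℝ C := convex_convexHull ℝ _
    have h0 : (0 : Fin n → ℝ) ∈ C := by
      let s : Fin n → SignType := fun _ => 1
      have hs : s ≠ 0 := fun h => by
        have := congrFun h ⟨0, hn⟩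
        simp [s] at this
      have hs' : -s ≠ 0 := fun h => by
        have := congrFun h ⟨0, hn⟩
        simp [s] at this
      have := hconv.midpoint_mem (hmem s hs) (hmem (-s) hs')
      rwa [signVertex_neg, midpoint_self_neg] at this
    obtain ⟨π, ε, w, s, hw, hs0, hs, rfl⟩ := exists_eq_sum_signVertex y
    have hle := mem_polarDual_permB.1 hy π ε
    simp only [map_sum, map_smul, (permFunctional_signVertex_eq_one (hs0 _)).2 (hs _), smul_eq_mul,
      mul_one] at hle
    have := hconv.sum_mem (t := Finset.univ) (w := fun o : Option (Fin n) =>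
      o.elim (1 - ∑ p, w p) w) (z := fun o => o.elim 0 fun p => signVertex (s p)) ?_ ?_ ?_
    · simpa [Fintype.sum_option] using this
    · rintro (_ | p) -
      · simpa using hle
      · exact hw p
    · simp [Fintype.sum_option]
    · rintro (_ | p) -
      · exact h0
      · exact hmem _ (hs0 p)
  · refine convexHull_min ?_ convex_polarDual_permB
    rintro _ ⟨s, hs, rfl⟩
    exact signVertex_mem hs

/-- A proper face is the convex hull of the vertices of a chain of sign vectors. -/
theorem IsProperFace.exists_isSignChain {F : Set (Fin n → ℝ)}
    (hF : IsProperFace (polarDual (permB n)) F) :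
    ∃ σ : Finset (Fin n → SignType), IsSignChain σ ∧
      (∀ s, s ∈ σ ↔ s ≠ 0 ∧ signVertex s ∈ F) ∧ F = convexHull ℝ (signVertex '' (σ : Set (Fin n → SignType))) := by
  classical
  obtain ⟨hexp, hne⟩ := hF
  set σ : Finset (Fin n → SignType) := Finset.univ.filter fun s => s ≠ 0 ∧ signVertex s ∈ F with hσ
  have hmem : ∀ s, s ∈ σ ↔ s ≠ 0 ∧ signVertex s ∈ F := by simp [hσ]
  have hconv : Convex ℝ F := hexp.convex convex_polarDual_permB
  have hkey : ∀ y ∈ F, y ∈ convexHull ℝ (signVertex '' (σ : Set (Fin n → SignType))) ∧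
      ∃ π ε, permFunctional π ε y = 1 := by
    intro y hy
    obtain ⟨l, hl⟩ := hexp ⟨y, hy⟩
    have hyF := hy
    rw [hl] at hyF
    obtain ⟨hyQ, hymax⟩ := hyF
    -- Were the maximum of `l` zero, central symmetry would make `l` vanish on the whole polytope,
    -- and the face would not be proper.
    have hpos : 0 < l y := by
      have h0 : 0 ≤ l y := by simpa using hymax 0 zero_mem_polarDual_permB
      refine lt_of_le_of_ne h0 fun h => hne ?_
      rw [hl]
      refine Set.Subset.antisymm (fun _ hx => hx.1) fun x hx => ⟨hx, fun z hz => ?_⟩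
      have h1 := hymax z hz
      have h2 := hymax _ (neg_mem_polarDual_permB hx)
      rw [map_neg] at h2
      linarith
    have hF' : ∀ x ∈ polarDual (permB n), l x = l y → x ∈ F := fun x hx h => by
      rw [hl]
      exact ⟨hx, fun z hz => h ▸ hymax z hz⟩
    obtain ⟨π, ε, w, s, hw, hs0, hs, rfl⟩ := exists_eq_sum_signVertex y
    set y := ∑ p, w p • signVertex (s p) with hy'
    have hle := mem_polarDual_permB.1 hyQ π ε
    have hval : permFunctional π ε y = ∑ p, w p := by
      simp only [hy', map_sum, map_smul, (permFunctional_signVertex_eq_one (hs0 _)).2 (hs _),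
        smul_eq_mul, mul_one]
    rw [hval] at hle
    have hly : l y = ∑ p, w p * l (signVertex (s p)) := by
      simp only [hy', map_sum, map_smul, smul_eq_mul]
    have hterm : ∀ p ∈ Finset.univ, w p * l (signVertex (s p)) ≤ w p * l y := fun p _ =>
      mul_le_mul_of_nonneg_left (hymax _ (signVertex_mem (hs0 p))) (hw p)
    have hsum := Finset.sum_le_sum hterm
    rw [← Finset.sum_mul, ← hly] at hsum
    -- As `l y ≤ (∑ p, w p) * l y` with `l y` positive, the weights sum to `1`; equality then puts
    -- every vertex of nonzero weight into `F`.
    have hone : ∑ p, w p = 1 := by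
      refine le_antisymm hle ?_
      by_contra hlt
      nlinarith [not_le.1 hlt]
    have heq := (Finset.sum_eq_sum_iff_of_le hterm).1 (by rw [← Finset.sum_mul, ← hly, hone, one_mul])
    refine ⟨?_, π, ε, hval.trans hone⟩
    have hmemσ : ∀ p, w p ≠ 0 → s p ∈ σ := fun p hp =>
      (hmem _).2 ⟨hs0 p, hF' _ (signVertex_mem (hs0 p))
        (mul_left_cancel₀ hp (heq p (Finset.mem_univ p)))⟩
    have hy2 : y = ∑ p ∈ Finset.univ.filter (fun p : Fin n => w p ≠ 0), w p • signVertex (s p) := by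
      symm
      refine Finset.sum_filter_of_ne fun p _ hp h => hp ?_
      rw [h, zero_smul]
    have hone2 : ∑ p ∈ Finset.univ.filter (fun p : Fin n => w p ≠ 0), w p = 1 := by
      rw [← hone]
      exact Finset.sum_filter_of_ne fun p _ hp => hp
    rw [hy2]
    refine (convex_convexHull ℝ _).sum_mem (fun p _ => hw p) hone2 fun p hp => ?_
    exact subset_convexHull ℝ _ ⟨s p, hmemσ p (Finset.mem_filter.1 hp).2, rfl⟩
  refine ⟨σ, ⟨fun s hs => ((hmem s).1 hs).1, fun s hs t ht => ?_⟩, hmem, ?_⟩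
  · rw [hmem] at hs ht
    -- The midpoint of two vertices of `F` lies on some facet, which must then contain both of them.
    obtain ⟨-, π, ε, h⟩ := hkey _ (hconv hs.2 ht.2 (a := 1 / 2) (b := 1 / 2) (by norm_num)
      (by norm_num) (by norm_num))
    rw [map_add, map_smul, map_smul, smul_eq_mul, smul_eq_mul] at h
    have h1 := permFunctional_signVertex_le π ε hs.1
    have h2 := permFunctional_signVertex_le π ε ht.1
    have hs' := (permFunctional_signVertex_eq_one (π := π) (ε := ε) hs.1).1 (by linarith)
    have ht' := (permFunctional_signVertex_eq_one (π := π) (ε := ε) ht.1).1 (by linarith)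
    exact hs'.isRestriction_or ht'
  · refine Set.Subset.antisymm (fun y hy => (hkey y hy).1) (convexHull_min ?_ hconv)
    rintro _ ⟨s, hs, rfl⟩
    exact ((hmem s).1 hs).2

/-- If `t` were not in the chain, a facet containing the chain could be exchanged for one that still
contains the chain but avoids `t`. -/
theorem IsSignChain.eq_of_forall_isCompatible {σ : Finset (Fin n → SignType)}
    (hσ : IsSignChain σ) {t : Fin n → SignType} (ht : t ≠ 0)
    (h : ∀ π ε, (∀ s ∈ σ, IsCompatible π ε s) → IsCompatible π ε t) : t ∈ σ := by
  obtain ⟨π, ε, hπ⟩ := hσ.exists_isCompatible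
  by_contra htσ
  obtain ⟨π', ε', h1, h2⟩ := exists_isCompatible_and_not ht (h π ε hπ)
  exact h2 (h π' ε' fun s hs => h1 s (fun hst => htσ (hst ▸ hs)) (hπ s hs))

/-- The vertices of a chain of sign vectors span a proper face. -/
theorem IsSignChain.isProperFace {σ : Finset (Fin n → SignType)} (hσ : IsSignChain σ) :
    IsProperFace (polarDual (permB n)) (convexHull ℝ (signVertex '' (σ : Set (Fin n → SignType)))) ∧
      ∀ t, t ≠ 0 → signVertex t ∈ convexHull ℝ (signVertex '' (σ : Set (Fin n → SignType))) → t ∈ σ := by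
  classical
  rcases σ.eq_empty_or_nonempty with rfl | ⟨s₀, hs₀⟩
  · simp only [Finset.coe_empty, Set.image_empty, convexHull_empty, Set.mem_empty_iff_false,
      false_imp_iff, implies_true, and_true]
    -- The empty set is vacuously exposed.
    exact ⟨fun h => absurd h Set.not_nonempty_empty,
      fun h => Set.notMem_empty _ (h ▸ zero_mem_polarDual_permB)⟩
  · let G : Finset (Equiv.Perm (Fin n) × (Fin n → ℤˣ)) :=
      Finset.univ.filter fun g => ∀ s ∈ σ, IsCompatible g.1 g.2 s
    have hG : ∀ g, g ∈ G ↔ ∀ s ∈ σ, IsCompatible g.1 g.2 s := by simp [G]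
    -- Summing the functionals of all facets through the chain exposes the intersection of these
    -- facets.
    let l : StrongDual ℝ (Fin n → ℝ) := ∑ g ∈ G, permFunctional g.1 g.2
    have hl : ∀ y, l y = ∑ g ∈ G, permFunctional g.1 g.2 y := by simp [l]
    let F : Set (Fin n → ℝ) := {y | y ∈ polarDual (permB n) ∧ ∀ z ∈ polarDual (permB n), l z ≤ l y}
    have hle : ∀ y ∈ polarDual (permB n), ∀ g ∈ G, permFunctional g.1 g.2 y ≤ 1 :=
      fun y hy g _ => mem_polarDual_permB.1 hy _ _
    have hvert : ∀ s ∈ σ, l (signVertex s) = ∑ g ∈ G, (1 : ℝ) := by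
      intro s hs
      rw [hl]
      exact Finset.sum_congr rfl fun g hg =>
        (permFunctional_signVertex_eq_one (hσ.1 s hs)).2 ((hG g).1 hg s hs)
    have hFmem : ∀ y ∈ polarDual (permB n), y ∈ F ↔ ∀ g ∈ G, permFunctional g.1 g.2 y = 1 := by
      intro y hy
      rw [← Finset.sum_eq_sum_iff_of_le (hle y hy), ← hl]
      constructor
      · intro h
        refine le_antisymm ?_ ?_
        · rw [hl]; exact Finset.sum_le_sum (hle y hy)
        · rw [← hvert s₀ hs₀]; exact h.2 _ (signVertex_mem (hσ.1 s₀ hs₀))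
      · intro h
        refine ⟨hy, fun z hz => ?_⟩
        rw [h, hl]
        exact Finset.sum_le_sum (hle z hz)
    have hF : IsProperFace (polarDual (permB n)) F := by
      refine ⟨fun _ => ⟨l, rfl⟩, fun h => ?_⟩
      obtain ⟨π, ε, hπ⟩ := hσ.exists_isCompatible
      have h0 := (hFmem 0 zero_mem_polarDual_permB).1 (h ▸ zero_mem_polarDual_permB) (π, ε)
        ((hG _).2 hπ)
      simp at h0
    obtain ⟨σ', -, hσ'mem, hσ'F⟩ := hF.exists_isSignChain
    have hσσ' : σ' = σ := by
      ext t
      rw [hσ'mem]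
      constructor
      · rintro ⟨ht0, ht⟩
        refine hσ.eq_of_forall_isCompatible ht0 fun π ε hπ => ?_
        rw [← permFunctional_signVertex_eq_one ht0]
        exact (hFmem _ (signVertex_mem ht0)).1 ht (π, ε) ((hG _).2 hπ)
      · intro ht
        have ht0 := hσ.1 t ht
        refine ⟨ht0, (hFmem _ (signVertex_mem ht0)).2 fun g hg => ?_⟩
        exact (permFunctional_signVertex_eq_one ht0).2 ((hG g).1 hg t ht)
    rw [hσσ'] at hσ'F hσ'mem
    rw [← hσ'F]
    exact ⟨hF, fun t ht0 ht => (hσ'mem t).2 ⟨ht0, ht⟩⟩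

theorem isSignChain_singleton {s : Fin n → SignType} (hs : s ≠ 0) : IsSignChain {s} := by
  refine ⟨by simpa using hs, fun a ha b hb => Or.inl ?_⟩
  rw [Finset.mem_singleton] at ha hb
  rw [ha, hb]
  exact fun _ _ => rfl

/-- A one-element chain spans a face containing no other sign vertex. -/
theorem signVertex_injOn : Set.InjOn signVertex {s : Fin n → SignType | s ≠ 0} := by
  intro s hs t ht h
  have := (isSignChain_singleton hs).isProperFace.2 t ht (by simp [h])
  exact (Finset.mem_singleton.1 this).symm

theorem signVertex_mem_extremePoints {s : Fin n → SignType} (hs : s ≠ 0) :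
    signVertex s ∈ (polarDual (permB n)).extremePoints ℝ := by
  have := (isSignChain_singleton hs).isProperFace.1.1.isExtreme
  simpa using this

theorem IsSignChain.extremePoints_convexHull {σ : Finset (Fin n → SignType)}
    (hσ : IsSignChain σ) : (convexHull ℝ (signVertex '' (σ : Set (Fin n → SignType)))).extremePoints ℝ =
      signVertex '' (σ : Set (Fin n → SignType)) := by
  refine Set.Subset.antisymm extremePoints_convexHull_subset ?_
  rintro _ ⟨s, hs, rfl⟩
  exact inter_extremePoints_subset_extremePoints_of_subset hσ.isProperFace.1.1.subset
    ⟨subset_convexHull ℝ _ ⟨s, hs, rfl⟩, signVertex_mem_extremePoints (hσ.1 s hs)⟩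

/-- For each `t` in the chain, the functionals of two facets that agree on all other members but
differ at `t` have a difference that isolates the coefficient of `t`. -/
theorem IsSignChain.linearIndependent {σ : Finset (Fin n → SignType)} (hσ : IsSignChain σ) :
    LinearIndependent ℝ fun s : σ => signVertex (s : Fin n → SignType) := by
  classical
  obtain ⟨π, ε, hπ⟩ := hσ.exists_isCompatible
  rw [linearIndependent_iff']
  intro A c hc t htA
  have ht0 := hσ.1 t t.2
  obtain ⟨π', ε', h1, h2⟩ := exists_isCompatible_and_not ht0 (hπ t t.2)
  have happ := congrArg (permFunctional π ε - permFunctional π' ε') hc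
  rw [map_sum, map_zero, Finset.sum_eq_single t] at happ
  · rw [map_smul, smul_eq_mul] at happ
    refine (mul_eq_zero.1 happ).resolve_right fun h => h2 ?_
    rw [sub_apply, (permFunctional_signVertex_eq_one ht0).2 (hπ t t.2),
      sub_eq_zero] at h
    exact (permFunctional_signVertex_eq_one ht0).1 h.symm
  · intro s _ hst
    have hs0 := hσ.1 s s.2
    rw [map_smul, sub_apply,
      (permFunctional_signVertex_eq_one hs0).2 (hπ s s.2),
      (permFunctional_signVertex_eq_one hs0).2 (h1 s (fun h => hst (Subtype.ext h)) (hπ s s.2)),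
      sub_self, smul_zero]
  · exact fun h => absurd htA h

theorem IsSignChain.isGeometricSimplex {σ : Finset (Fin n → SignType)} (hσ : IsSignChain σ) :
    IsGeometricSimplex (convexHull ℝ (signVertex '' (σ : Set (Fin n → SignType)))) := by
  classical
  refine ⟨σ.image signVertex, ?_, by rw [Finset.coe_image]⟩
  have h := hσ.linearIndependent.affineIndependent.range
  have hr : Set.range (fun s : σ => signVertex (s : Fin n → SignType)) =
      ((σ.image signVertex : Finset _) : Set (Fin n → ℝ)) := by
    ext x; simp
  rw [hr] at h
  exact h

theorem isSimplicialPolytope_polarDual_permB (hn : 1 ≤ n) :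
    IsSimplicialPolytope (polarDual (permB n)) := by
  classical
  refine ⟨⟨(Finset.univ.filter fun s : Fin n → SignType => s ≠ 0).image signVertex, ?_⟩,
    fun F hF => ?_⟩
  · rw [polarDual_permB_eq_convexHull hn, Finset.coe_image, Finset.coe_filter]
    simp
  · obtain ⟨σ, hσ, -, rfl⟩ := hF.exists_isSignChain
    exact hσ.isGeometricSimplex

theorem mem_boundaryComplex_polarDual_permB [DecidableEq (Fin n → ℝ)]
    {ρ : Finset (Fin n → ℝ)} : ρ ∈ boundaryComplex (polarDual (permB n)) ↔
      ∃ σ : Finset (Fin n → SignType), IsSignChain σ ∧ ρ = σ.image signVertex := by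
  constructor
  · rintro ⟨F, hF, hρ⟩
    obtain ⟨σ, hσ, -, rfl⟩ := hF.exists_isSignChain
    refine ⟨σ, hσ, ?_⟩
    rw [hσ.extremePoints_convexHull] at hρ
    apply Finset.coe_injective
    rw [hρ, Finset.coe_image]
  · rintro ⟨σ, hσ, rfl⟩
    exact ⟨_, hσ.isProperFace.1, by rw [hσ.extremePoints_convexHull, Finset.coe_image]⟩

end Faces

/-! ### Transport of complexes along maps injective on vertices. -/

theorem combEquiv_image {α β : Type*} [DecidableEq α] {L : Set (Finset β)} {ψ : β → α}
    (hψ : Set.InjOn ψ (vertexSet L)) : CombEquiv ((fun ρ : Finset β => ρ.image ψ) '' L) L := by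
  classical
  let k : vertexSet L → vertexSet ((fun ρ : Finset β => ρ.image ψ) '' L) := fun b =>
    ⟨ψ b, by
      obtain ⟨ρ, hρ, hb⟩ := b.2
      exact ⟨_, ⟨ρ, hρ, rfl⟩, Finset.mem_image_of_mem ψ hb⟩⟩
  have hk : Function.Bijective k := by
    constructor
    · intro a b h
      exact Subtype.ext (hψ a.2 b.2 (congrArg Subtype.val h))
    · rintro ⟨x, _, ⟨ρ, hρ, rfl⟩, hx⟩
      obtain ⟨b, hb, rfl⟩ := Finset.mem_image.1 hx
      exact ⟨⟨b, ρ, hρ, hb⟩, rfl⟩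
  let f := Equiv.ofBijective k hk
  refine ⟨f.symm, fun s => ?_⟩
  set t := s.map f.symm.toEmbedding with ht
  have hs : s = t.map f.toEmbedding := by
    rw [ht, Finset.map_map]
    ext x
    simp
  have himage : s.map (Function.Embedding.subtype _) =
      (t.map (Function.Embedding.subtype _)).image ψ := by
    rw [hs, Finset.map_eq_image, Finset.map_eq_image, Finset.map_eq_image, Finset.image_image,
      Finset.image_image]
    rfl
  rw [himage]
  constructor
  · rintro ⟨ρ, hρ, h⟩
    have hρt : ρ = t.map (Function.Embedding.subtype _) := by
      have hmem : ∀ b ∈ t.map (Function.Embedding.subtype _), b ∈ vertexSet L := by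
        intro b hb
        obtain ⟨c, -, rfl⟩ := Finset.mem_map.1 hb
        exact c.2
      have hinj := hψ.image_eq_image_iff (s₁ := (ρ : Set β))
        (s₂ := (t.map (Function.Embedding.subtype _) : Finset β)) (fun b hb => ⟨ρ, hρ, hb⟩) hmem
      refine Finset.coe_injective (hinj.1 ?_)
      rw [← Finset.coe_image, ← Finset.coe_image]
      exact congrArg _ h
    rwa [hρt] at hρ
  · exact fun h => ⟨_, h, rfl⟩

/-! ### The fully subdivided complex as an order complex of intervals. -/

section Intervals

variable {V Q : Type*} [DecidableEq V] [Lattice Q] [BoundedOrder Q] {g : V → Q}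

theorem PartialAdj.lowerEnd_le_upperEnd (hg : Function.Injective g) {a : V ⊕ Finset V}
    (ha : PartialAdj g (properEdges g) a a) : lowerEnd g a ≤ upperEnd g a := by
  rcases a with x | e
  · exact le_rfl
  · obtain ⟨x, y, hxy, -, rfl⟩ := exists_lt_of_mem_properEdges hg ha.1
    rw [lowerEnd_pair hxy.le, upperEnd_pair hxy.le]
    exact hxy.le

theorem PartialAdj.not_bot_and_top [Nontrivial Q] (hg : Function.Injective g) {a : V ⊕ Finset V}
    (ha : PartialAdj g (properEdges g) a a) : ¬ (lowerEnd g a = ⊥ ∧ upperEnd g a = ⊤) := by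
  rcases a with x | e
  · exact fun h => bot_ne_top (h.1.symm.trans h.2)
  · obtain ⟨x, y, hxy, hc, rfl⟩ := exists_lt_of_mem_properEdges hg ha.1
    rw [lowerEnd_pair hxy.le, upperEnd_pair hxy.le]
    have := hc.2
    rwa [inf_eq_left.2 hxy.le, sup_eq_right.2 hxy.le] at this

theorem not_intervalLE_inr_inl (hg : Function.Injective g) {x : V} {e : Finset V}
    (he : e ∈ properEdges g) : ¬ IntervalLE g (Sum.inr e) (Sum.inl x) := by
  obtain ⟨y, z, hyz, -, rfl⟩ := exists_lt_of_mem_properEdges hg he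
  rintro ⟨h1, h2⟩
  rw [lowerEnd_pair hyz.le] at h1
  rw [upperEnd_pair hyz.le] at h2
  exact (h2.trans h1).not_gt hyz

/-- After the subdivision of all edges, adjacency is comparability of intervals. -/
theorem partialAdj_properEdges_iff [Nontrivial Q] (hg : Function.Injective g)
    {a b : V ⊕ Finset V} : PartialAdj g (properEdges g) a b ↔
      PartialAdj g (properEdges g) a a ∧ PartialAdj g (properEdges g) b b ∧
        (IntervalLE g a b ∨ IntervalLE g b a) := by
  have hself : ∀ x, PartialAdj g (properEdges g) (Sum.inl x) (Sum.inl x) := by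
    refine fun x => ⟨⟨Or.inl le_rfl, ?_⟩, ?_⟩
    · rw [inf_idem, sup_idem]
      exact fun h => bot_ne_top (h.1.symm.trans h.2)
    · rintro ⟨y, z, hyz, -, h⟩
      have := congrArg Finset.card h
      rw [Finset.card_pair hyz] at this
      simp at this
  have hedge : ∀ {e}, e ∈ properEdges g →
      PartialAdj g (properEdges g) (Sum.inr e) (Sum.inr e) := fun he =>
    ⟨he, he, Or.inl ⟨le_rfl, le_rfl⟩⟩
  rcases a with x | e <;> rcases b with y | f
  · constructor
    · rintro ⟨h1, h2⟩
      have : x = y := by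
        by_contra hxy
        exact h2 ⟨x, y, hxy, h1, rfl⟩
      subst this
      exact ⟨hself x, hself x, Or.inl ⟨le_rfl, le_rfl⟩⟩
    · rintro ⟨-, -, h⟩
      have : x = y := hg (h.elim (fun h => le_antisymm h.2 h.1) fun h => le_antisymm h.1 h.2)
      subst this
      exact hself x
  · constructor
    · rintro ⟨hf, h⟩
      exact ⟨hself x, hedge hf, Or.inl h⟩
    · rintro ⟨-, hf, h⟩
      exact ⟨hf.1, h.resolve_right (not_intervalLE_inr_inl hg hf.1)⟩
  · constructor
    · rintro ⟨he, h⟩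
      exact ⟨hedge he, hself y, Or.inr h⟩
    · rintro ⟨he, -, h⟩
      exact ⟨he.1, h.resolve_left (not_intervalLE_inr_inl hg he.1)⟩
  · constructor
    · rintro ⟨he, hf, h⟩
      exact ⟨hedge he, hedge hf, h⟩
    · rintro ⟨he, hf, h⟩
      exact ⟨he.1, hf.1, h⟩

theorem PartialAdj.eq_of_intervalLE (hg : Function.Injective g) {a b : V ⊕ Finset V}
    (ha : PartialAdj g (properEdges g) a a) (hb : PartialAdj g (properEdges g) b b)
    (hab : IntervalLE g a b) (hba : IntervalLE g b a) : a = b := by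
  rcases a with x | e <;> rcases b with y | f
  · rw [hg (le_antisymm hab.2 hba.2 : g x = g y)]
  · exact absurd hba (not_intervalLE_inr_inl hg hb.1)
  · exact absurd hab (not_intervalLE_inr_inl hg ha.1)
  · rw [eq_of_ends_eq hg ha.1 hb.1 (le_antisymm hba.1 hab.1) (le_antisymm hab.2 hba.2)]

end Intervals

/-! ### Boolean intervals as sign vectors. -/

section BooleanIntervals

variable {n : ℕ} {V : Type*} [DecidableEq V] {g : V → Finset (Fin n)}

variable (g) in
/-- The sign vector of an interval of the Boolean algebra: it is `1` on the lower end and `-1`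
outside of the upper end. -/
def intervalSign (a : V ⊕ Finset V) : Fin n → SignType := fun i =>
  if i ∈ lowerEnd g a then 1 else if i ∈ upperEnd g a then 0 else -1

theorem intervalSign_ne_zero [Nonempty (Fin n)] (hg : Function.Injective g) {a : V ⊕ Finset V}
    (ha : PartialAdj g (properEdges g) a a) : intervalSign g a ≠ 0 := by
  intro h
  refine ha.not_bot_and_top hg ⟨?_, ?_⟩
  · refine Finset.eq_empty_of_forall_notMem fun i hi => ?_
    have := congrFun h i
    simp [intervalSign, hi] at this
  · refine Finset.eq_univ_iff_forall.2 fun i => ?_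
    by_contra hi
    have := congrFun h i
    have hlo : i ∉ lowerEnd g a := fun h' => hi (ha.lowerEnd_le_upperEnd hg h')
    simp [intervalSign, hi, hlo] at this

/-- Enlarging an interval turns nonzero signs into zeros, so the order is reversed. -/
theorem isRestriction_intervalSign_iff (hg : Function.Injective g) {a b : V ⊕ Finset V}
    (ha : PartialAdj g (properEdges g) a a) (hb : PartialAdj g (properEdges g) b b) :
    IsRestriction (intervalSign g b) (intervalSign g a) ↔ IntervalLE g a b := by
  have ha' := ha.lowerEnd_le_upperEnd hg
  have hb' := hb.lowerEnd_le_upperEnd hg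
  constructor
  · intro h
    constructor
    · intro i hi
      by_contra hia
      have := h i (by simp [intervalSign, hi])
      by_cases hia' : i ∈ upperEnd g a <;> simp [intervalSign, hi, hia, hia'] at this
    · intro i hi
      by_contra hib
      have hib' : i ∉ lowerEnd g b := fun h' => hib (hb' h')
      have := h i (by simp [intervalSign, hib, hib'])
      by_cases hia' : i ∈ lowerEnd g a <;> simp [intervalSign, hi, hib, hib', hia'] at this
  · rintro ⟨h1, h2⟩ i hi
    by_cases hlo : i ∈ lowerEnd g b
    · simp [intervalSign, hlo, h1 hlo]
    · by_cases hup : i ∈ upperEnd g b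
      · simp [intervalSign, hlo, hup] at hi
      · have h3 : i ∉ upperEnd g a := fun h => hup (h2 h)
        have h4 : i ∉ lowerEnd g a := fun h => h3 (ha' h)
        simp [intervalSign, hlo, hup, h3, h4]

theorem exists_intervalSign_eq [Nonempty (Fin n)] (hg : Function.Bijective g)
    {s : Fin n → SignType} (hs : s ≠ 0) :
    ∃ a, PartialAdj g (properEdges g) a a ∧ intervalSign g a = s := by
  obtain ⟨x, hx⟩ := hg.2 (Finset.univ.filter fun i => s i = 1)
  obtain ⟨y, hy⟩ := hg.2 (Finset.univ.filter fun i => s i ≠ -1)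
  have hle : g x ≤ g y := by
    rw [hx, hy]
    intro i hi
    simp only [Finset.mem_filter, Finset.mem_univ, true_and] at hi ⊢
    simp [hi]
  have hsign : ∀ a, lowerEnd g a = g x → upperEnd g a = g y → intervalSign g a = s := by
    intro a h1 h2
    funext i
    simp only [intervalSign, h1, h2, hx, hy, Finset.mem_filter, Finset.mem_univ, true_and]
    generalize s i = z
    revert z
    decide
  -- The ends coincide exactly when `s` has full support; the label is then an original vertex
  -- instead of a midpoint.
  by_cases hxy : x = y
  · subst hxy
    refine ⟨Sum.inl x, ⟨⟨Or.inl le_rfl, ?_⟩, ?_⟩, hsign _ rfl rfl⟩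
    · rw [inf_idem, sup_idem]
      exact fun h => bot_ne_top (h.1.symm.trans h.2)
    · rintro ⟨y, z, hyz, -, h⟩
      have := congrArg Finset.card h
      rw [Finset.card_pair hyz] at this
      simp at this
  · have hc : ProperComparable g x y := by
      refine ⟨Or.inl hle, ?_⟩
      rw [inf_eq_left.2 hle, sup_eq_right.2 hle]
      rintro ⟨h1, h2⟩
      refine hs (funext fun i => ?_)
      have h3 : i ∉ g x := by rw [h1]; simp
      have h4 : i ∈ g y := by rw [h2]; simp
      rw [hx] at h3
      rw [hy] at h4
      simp only [Finset.mem_filter, Finset.mem_univ, true_and] at h3 h4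
      change s i = 0
      generalize s i = z at h3 h4
      revert z
      decide
    have he : ({x, y} : Finset V) ∈ properEdges g := ⟨x, y, hxy, hc, rfl⟩
    exact ⟨Sum.inr {x, y}, ⟨he, he, Or.inl ⟨le_rfl, le_rfl⟩⟩,
      hsign _ (lowerEnd_pair hle) (upperEnd_pair hle)⟩

theorem combEquiv_boundaryComplex_partialAdj [Nonempty (Fin n)] (hg : Function.Bijective g) :
    CombEquiv (boundaryComplex (polarDual (permB n)))
      (flagComplex (PartialAdj g (properEdges g))) := by
  classical
  have h : boundaryComplex (polarDual (permB n)) =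
      (fun ρ : Finset (V ⊕ Finset V) => ρ.image (signVertex ∘ intervalSign g)) ''
        flagComplex (PartialAdj g (properEdges g)) := by
    ext τ
    rw [mem_boundaryComplex_polarDual_permB]
    constructor
    · rintro ⟨σ, hσ, rfl⟩
      have : ∀ s : Fin n → SignType, ∃ a, s ≠ 0 →
          PartialAdj g (properEdges g) a a ∧ intervalSign g a = s := by
        intro s
        by_cases hs : s = 0
        -- An arbitrary label; the zero vector belongs to no chain.
        · exact ⟨Sum.inr ∅, fun h => absurd hs h⟩
        · obtain ⟨a, ha⟩ := exists_intervalSign_eq hg hs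
          exact ⟨a, fun _ => ha⟩
      choose inv hinv using this
      refine ⟨σ.image inv, ?_, ?_⟩
      · intro a ha b hb
        obtain ⟨s, hs, rfl⟩ := Finset.mem_image.1 ha
        obtain ⟨t, ht, rfl⟩ := Finset.mem_image.1 hb
        obtain ⟨has, hsa⟩ := hinv s (hσ.1 s hs)
        obtain ⟨hat, hta⟩ := hinv t (hσ.1 t ht)
        rw [partialAdj_properEdges_iff hg.1, ← isRestriction_intervalSign_iff hg.1 has hat,
          ← isRestriction_intervalSign_iff hg.1 hat has, hsa, hta]
        exact ⟨has, hat, hσ.2 t ht s hs⟩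
      · simp only [Finset.image_image]
        refine Finset.image_congr fun s hs => ?_
        simp only [Function.comp_apply, (hinv s (hσ.1 s hs)).2]
    · rintro ⟨ρ, hρ, rfl⟩
      refine ⟨ρ.image (intervalSign g), ⟨fun s hs => ?_, fun s hs t ht => ?_⟩, ?_⟩
      · obtain ⟨a, ha, rfl⟩ := Finset.mem_image.1 hs
        exact intervalSign_ne_zero hg.1 (hρ a ha a ha)
      · obtain ⟨a, ha, rfl⟩ := Finset.mem_image.1 hs
        obtain ⟨b, hb, rfl⟩ := Finset.mem_image.1 ht
        rw [isRestriction_intervalSign_iff hg.1 (hρ b hb b hb) (hρ a ha a ha),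
          isRestriction_intervalSign_iff hg.1 (hρ a ha a ha) (hρ b hb b hb)]
        exact ((partialAdj_properEdges_iff hg.1).1 (hρ b hb a ha)).2.2
      · rw [Finset.image_image]
  rw [h]
  refine combEquiv_image fun a ha b hb hab => ?_
  rw [mem_vertexSet_flagComplex] at ha hb
  have hs := signVertex_injOn (intervalSign_ne_zero hg.1 ha) (intervalSign_ne_zero hg.1 hb) hab
  refine ha.eq_of_intervalLE hg.1 hb ?_ ?_
  · rw [← isRestriction_intervalSign_iff hg.1 ha hb, hs]
    exact fun _ _ => rfl
  · rw [← isRestriction_intervalSign_iff hg.1 hb ha, hs]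
    exact fun _ _ => rfl

end BooleanIntervals

/-! ### The suspension inside the Boolean algebra. -/

section Suspension

variable {n : ℕ}

/-- The suspension vertices are identified with the empty set and the full set. -/
def suspensionVertex : ProperNonemptySubset n ⊕ Bool → Finset (Fin n)
  | Sum.inl S => S.1
  | Sum.inr false => ∅
  | Sum.inr true => Finset.univ

theorem suspensionVertex_bijective [Nonempty (Fin n)] :
    Function.Bijective (suspensionVertex (n := n)) := by
  have hne : (∅ : Finset (Fin n)) ≠ Finset.univ := bot_ne_top
  constructor
  · rintro (S | _ | _) (T | _ | _) h <;> simp only [suspensionVertex] at h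
    · rw [Subtype.ext h]
    · exact absurd h S.2.1
    · exact absurd h S.2.2
    · exact absurd h.symm T.2.1
    · rfl
    · exact absurd h hne
    · exact absurd h.symm T.2.2
    · exact absurd h.symm hne
    · rfl
  · intro S
    by_cases h0 : S = ∅
    · exact ⟨Sum.inr false, h0.symm⟩
    · by_cases h1 : S = Finset.univ
      · exact ⟨Sum.inr true, h1.symm⟩
      · exact ⟨Sum.inl ⟨S, h0, h1⟩, rfl⟩

theorem properComparable_suspensionVertex [Nonempty (Fin n)]
    {x y : ProperNonemptySubset n ⊕ Bool} : ProperComparable suspensionVertex x y ↔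
      (∀ S T, x = Sum.inl S → y = Sum.inl T → S ≤ T ∨ T ≤ S) ∧
        (∀ b c, x = Sum.inr b → y = Sum.inr c → b = c) := by
  have hne : (∅ : Finset (Fin n)) ≠ Finset.univ := bot_ne_top
  rcases x with S | _ | _ <;> rcases y with T | _ | _ <;>
    simp [ProperComparable, suspensionVertex, hne, hne.symm]
  all_goals first
    | exact S.2.2
    | exact S.2.1
    | exact T.2.2
    | exact T.2.1
    | skip
  intro h h0 h1
  rcases h with h | h
  · have : S.1 ⊆ T.1 := h
    rw [Finset.inter_eq_left.2 this] at h0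
    exact S.2.1 h0
  · have : T.1 ⊆ S.1 := h
    rw [Finset.inter_eq_right.2 this] at h0
    exact T.2.1 h0

/-- Each suspension point is comparable to every set, and the one pair excluded by
`ProperComparable` is the segment missing from `boundaryOfSegment`. -/
theorem mem_suspension_orderComplex [Nonempty (Fin n)]
    {σ : Finset (ProperNonemptySubset n ⊕ Bool)} :
    σ ∈ suspension (orderComplex (ProperNonemptySubset n)) ↔
      ∀ x ∈ σ, ∀ y ∈ σ, ProperComparable suspensionVertex x y := by
  constructor
  · rintro ⟨ρ, hρ, τ, hτ, rfl⟩ x hx y hy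
    rw [properComparable_suspensionVertex]
    refine ⟨?_, ?_⟩
    · rintro S T rfl rfl
      exact hρ.total (Finset.inl_mem_disjSum.1 hx) (Finset.inl_mem_disjSum.1 hy)
    · rintro b c rfl rfl
      by_contra hbc
      have hb := Finset.inr_mem_disjSum.1 hx
      have hc := Finset.inr_mem_disjSum.1 hy
      refine hτ (Finset.eq_univ_iff_forall.2 fun d => ?_)
      have : d = b ∨ d = c := by cases b <;> cases c <;> cases d <;> simp_all
      rcases this with rfl | rfl
      · exact hb
      · exact hc
  · intro h
    refine ⟨σ.toLeft, ?_, σ.toRight, ?_, Finset.toLeft_disjSum_toRight.symm⟩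
    · intro S hS T hT _
      exact (properComparable_suspensionVertex.1
        (h _ (Finset.mem_toLeft.1 hS) _ (Finset.mem_toLeft.1 hT))).1 S T rfl rfl
    · intro huniv
      have hmem : ∀ b, Sum.inr b ∈ σ := fun b => Finset.mem_toRight.1 (huniv ▸ Finset.mem_univ b)
      have := (properComparable_suspensionVertex.1 (h _ (hmem false) _ (hmem true))).2 _ _ rfl rfl
      exact Bool.false_ne_true this

end Suspension

theorem mainTheorem4 (n : ℕ) (hn : 1 ≤ n) :
    IsSimplicialPolytope (polarDual (permB n)) ∧
      ∃ T : Set (Finset ((ProperNonemptySubset n ⊕ Bool) ⊕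
          Finset (ProperNonemptySubset n ⊕ Bool))),
        IsTchebyshevTriangulation (suspension (orderComplex (ProperNonemptySubset n))) T ∧
          CombEquiv (boundaryComplex (polarDual (permB n))) T := by
  have : Nonempty (Fin n) := ⟨⟨0, hn⟩⟩
  refine ⟨isSimplicialPolytope_polarDual_permB hn, _,
    isTchebyshevTriangulation_partialAdj suspensionVertex_bijective.1
      (fun σ => mem_suspension_orderComplex) fun x => ?_,
    combEquiv_boundaryComplex_partialAdj suspensionVertex_bijective⟩
  refine ⟨Or.inl le_rfl, ?_⟩
  rw [inf_idem, sup_idem]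
  exact fun h => bot_ne_top (h.1.symm.trans h.2)
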